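/- \textbf{Theorem} (pure-state entanglement cost and distillable entanglement). Let $A$ and $B$ be finite-dimensional quantum systems and let $|\psi\rangle_{AB}\in\mathbb C^{A}\otimes\mathbb C^{B}$ be a unit vector, with reduced states $\rho_A=\operatorname{tr}_B|\psi\rangle\langle\psi|$ and $\rho_B=\operatorname{tr}_A|\psi\rangle\langle\psi|$. Then $$E_c(|\psi\rangle\langle\psi|_{AB})=E_D(|\psi\rangle\langle\psi|_{AB})=S(\rho_A)=S(\rho_B),$$ where $S(\rho)=-\operatorname{tr}\rho\log_2\rho$ (with $0\log_2 0=0$) and, for a state $\rho_{AB}$, $$E_D(\rho_{AB})=\lim_{\epsilon\to0^+}\lim_{n\to\infty}\max\Bigl\{\tfrac mn:\ \rho_{AB}^{\otimes n}\xrightarrow{\mathrm{LOCC}}\sigma_m,\ \bigl\|\sigma_m-|\Phi^+\rangle\langle\Phi^+|^{\otimes m}\bigr\|_1\le\epsilon\Bigr\},$$ $$E_c(\rho_{AB})=\lim_{\epsilon\to0^+}\lim_{n\to\infty}\min\Bigl\{\tfrac mn:\ |\Phi^+\rangle\langle\Phi^+|^{\otimes m}\xrightarrow{\mathrm{LOCC}}\sigma_n,\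 \bigl\|\sigma_n-\rho_{AB}^{\otimes n}\bigr\|_1\le\epsilon\Bigr\}.$$ It is part of the claim that for $\rho_{AB}=|\psi\rangle\langle\psi|$ the maxima and minima exist for all sufficiently small $\epsilon>0$ and all sufficiently large $n$, and that the limits exist. Here $m$ ranges over the non-negative integers, $|\Phi^+\rangle=(|00\rangle+|11\rangle)/\sqrt2$, $\|X\|_1=\operatorname{tr}\sqrt{X^\dagger X}$, the tensor powers are regarded as bipartite between all of Alice's and all of Bob's systems, and $\sigma_m$, $\sigma_n$ live on the same bipartite spaces as $|\Phi^+\rangle\langle\Phi^+|^{\otimes m}$, $\rho_{AB}^{\otimes n}$. An LOCC transformation is one implemented by a finite sequence of rounds; in each round one of the two parties (which may depend on the earlier outcomes) performs on her or his system a measurement with finitely many outcomes $i$ and Kraus operators $M_i$, $\sum_iM_i^\dagger M_i=I$, possibly mapping to another finite-dimensional system and chosen depending on all earlier outcomes, and announces the outcome to the other party. The output is the average over all outcomes, $\Lambda(\rho)=\sum_k (K_k\otimes L_k)\rho(K_k\otimes L_k)^\dagger$, where $K_k$ and $L_k$ are the products of Alice's and of Bob's Kraus operators along the $k$-th sequence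 of outcomes. -/

import Mathlib

open Filter Topology
open scoped Kronecker

noncomputable section

/-! A finite-dimensional quantum system is `ℂ^A` for a finite type `A` that labels an orthonormal
basis; the composite of `A` and `B` is `ℂ^A ⊗ ℂ^B = ℂ^(A × B)`.  Operators on it are matrices with
rows and columns indexed by `A × B`. -/

/-- The density matrix `|ψ⟩⟨ψ|`. -/
def pureState {X : Type} (ψ : EuclideanSpace ℂ X) : Matrix X X ℂ :=
  Matrix.of fun x y => ψ x * star (ψ y)

/-- The reduced state `ρ_A = tr_B ρ_{AB}`. -/
def reducedA {A B : Type} [Fintype B] (ρ : Matrix (A × B) (A × B) ℂ) : Matrix A A ℂ :=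
  Matrix.of fun a a' => ∑ b, ρ (a, b) (a', b)

/-- The reduced state `ρ_B = tr_A ρ_{AB}`. -/
def reducedB {A B : Type} [Fintype A] (ρ : Matrix (A × B) (A × B) ℂ) : Matrix B B ℂ :=
  Matrix.of fun b b' => ∑ a, ρ (a, b) (a, b')

/-- The von Neumann entropy `S(ρ) = -tr ρ log ρ`, with the logarithm to base two applied to the
Hermitian matrix `ρ` by the functional calculus (`Real.logb 2 0 = 0` gives `0 log 0 = 0`). -/
def vonNeumannEntropy {X : Type} [Fintype X] [DecidableEq X] (ρ : Matrix X X ℂ) : ℝ :=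
  -(Matrix.trace (ρ * cfc (Real.logb 2) ρ)).re

/-- The trace norm `‖X‖₁ = tr √(Xᴴ X)`. -/
def traceNorm {X : Type} [Fintype X] [DecidableEq X] (M : Matrix X X ℂ) : ℝ :=
  (Matrix.trace (cfc Real.sqrt (M.conjTranspose * M))).re

/-- The tensor power `ρ_{AB}^{⊗ n}`, as a matrix for the bipartite system `Aⁿ : Bⁿ`; the basis of
`Aⁿ` is labelled by `Fin n → A`. -/
def tensorPower {A B : Type} (n : ℕ) (ρ : Matrix (A × B) (A × B) ℂ) :
    Matrix ((Fin n → A) × (Fin n → B)) ((Fin n → A) × (Fin n → B)) ℂ :=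
  Matrix.of fun x y => ∏ i, ρ (x.1 i, x.2 i) (y.1 i, y.2 i)

/-- The EPR pair `|Φ⁺⟩ = (|00⟩ + |11⟩) / √2`. -/
def eprPair : EuclideanSpace ℂ (Fin 2 × Fin 2) :=
  WithLp.toLp 2 fun x => if x.1 = x.2 then ((1 / Real.sqrt 2 : ℝ) : ℂ) else 0

/-- `IsLOCC A B Λ`: the map `Λ`, from operators on the bipartite system `A : B` to operators on the
bipartite system `A' : B'`, is implemented by a finite protocol of local operations and classical
communication.  Either nothing (more) is done, or one of the parties performs a measurement with
finitely many outcomes and Kraus operators `M i` (with `∑ i, (M i)ᴴ * M i = 1`; the system of that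
party may change from `A` to any finite-dimensional system `X`, which covers adding ancillas, local
isometries and discarding subsystems), announces the outcome `i` to the other party, and the two
go on with an LOCC protocol `Λ i` that may depend on `i`. -/
inductive IsLOCC {A' B' : Type} [Fintype A'] [DecidableEq A'] [Fintype B'] [DecidableEq B'] :
    (A B : Type) → [Fintype A] → [DecidableEq A] → [Fintype B] → [DecidableEq B] →
      (Matrix (A × B) (A × B) ℂ → Matrix (A' × B') (A' × B') ℂ) → Prop
  | done : IsLOCC A' B' (fun ρ => ρ)
  | alice {A B X ι : Type} [Fintype A] [DecidableEq A] [Fintype B] [DecidableEq B]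
      [Fintype X] [DecidableEq X] [Fintype ι]
      (M : ι → Matrix X A ℂ) (hM : ∑ i, (M i).conjTranspose * M i = 1)
      (Λ : ι → Matrix (X × B) (X × B) ℂ → Matrix (A' × B') (A' × B') ℂ)
      (hΛ : ∀ i, IsLOCC X B (Λ i)) :
      IsLOCC A B (fun ρ => ∑ i,
        Λ i ((M i ⊗ₖ (1 : Matrix B B ℂ)) * ρ * (M i ⊗ₖ (1 : Matrix B B ℂ)).conjTranspose))
  | bob {A B X ι : Type} [Fintype A] [DecidableEq A] [Fintype B] [DecidableEq B]
      [Fintype X] [DecidableEq X] [Fintype ι]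
      (M : ι → Matrix X B ℂ) (hM : ∑ i, (M i).conjTranspose * M i = 1)
      (Λ : ι → Matrix (A × X) (A × X) ℂ → Matrix (A' × B') (A' × B') ℂ)
      (hΛ : ∀ i, IsLOCC A X (Λ i)) :
      IsLOCC A B (fun ρ => ∑ i,
        Λ i (((1 : Matrix A A ℂ) ⊗ₖ M i) * ρ * ((1 : Matrix A A ℂ) ⊗ₖ M i).conjTranspose))

/-- The ratios `m / n` such that LOCC transforms `ρ^{⊗ n}` into a state `σ` on `m` pairs of qubits
with `‖σ - |Φ⁺⟩⟨Φ⁺|^{⊗ m}‖₁ ≤ ε`. -/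
def distillationRatios {A B : Type} [Fintype A] [DecidableEq A] [Fintype B] [DecidableEq B]
    (ρ : Matrix (A × B) (A × B) ℂ) (ε : ℝ) (n : ℕ) : Set ℝ :=
  {r | ∃ m : ℕ, r = (m : ℝ) / n ∧
    ∃ Λ, IsLOCC (A' := Fin m → Fin 2) (B' := Fin m → Fin 2) (Fin n → A) (Fin n → B) Λ ∧
      traceNorm (Λ (tensorPower n ρ) - tensorPower m (pureState eprPair)) ≤ ε}

/-- The ratios `m / n` such that LOCC transforms `|Φ⁺⟩⟨Φ⁺|^{⊗ m}` into a state `σ` with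
`‖σ - ρ^{⊗ n}‖₁ ≤ ε`. -/
def dilutionRatios {A B : Type} [Fintype A] [DecidableEq A] [Fintype B] [DecidableEq B]
    (ρ : Matrix (A × B) (A × B) ℂ) (ε : ℝ) (n : ℕ) : Set ℝ :=
  {r | ∃ m : ℕ, r = (m : ℝ) / n ∧
    ∃ Λ, IsLOCC (A' := Fin n → A) (B' := Fin n → B) (Fin m → Fin 2) (Fin m → Fin 2) Λ ∧
      traceNorm (Λ (tensorPower m (pureState eprPair)) - tensorPower n ρ) ≤ ε}

/-- `E` is the distillable entanglement
`E_D(ρ) = lim_{ε → 0} lim_{n → ∞} max (distillationRatios ρ ε n)`: the maxima `R ε n` (for all small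
`ε > 0` and all large `n`), the inner limits `L ε` and the outer limit exist, and `E` is the
outer limit. -/
def HasDistillableEntanglement {A B : Type} [Fintype A] [DecidableEq A] [Fintype B] [DecidableEq B]
    (ρ : Matrix (A × B) (A × B) ℂ) (E : ℝ) : Prop :=
  ∃ (R : ℝ → ℕ → ℝ) (L : ℝ → ℝ),
    (∀ᶠ ε in 𝓝[>] (0 : ℝ),
      (∀ᶠ n in atTop, IsGreatest (distillationRatios ρ ε n) (R ε n)) ∧
        Tendsto (R ε) atTop (𝓝 (L ε))) ∧
    Tendsto L (𝓝[>] (0 : ℝ)) (𝓝 E)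

/-- `E` is the entanglement cost
`E_c(ρ) = lim_{ε → 0} lim_{n → ∞} min (dilutionRatios ρ ε n)`: the minima `R ε n` (for all small
`ε > 0` and all large `n`), the inner limits `L ε` and the outer limit exist, and `E` is the
outer limit. -/
def HasEntanglementCost {A B : Type} [Fintype A] [DecidableEq A] [Fintype B] [DecidableEq B]
    (ρ : Matrix (A × B) (A × B) ℂ) (E : ℝ) : Prop :=
  ∃ (R : ℝ → ℕ → ℝ) (L : ℝ → ℝ),
    (∀ᶠ ε in 𝓝[>] (0 : ℝ),
      (∀ᶠ n in atTop, IsLeast (dilutionRatios ρ ε n) (R ε n)) ∧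
        Tendsto (R ε) atTop (𝓝 (L ε))) ∧
    Tendsto L (𝓝[>] (0 : ℝ)) (𝓝 E)

/-- The distillable entanglement is unique. -/
theorem HasDistillableEntanglement.unique {A B : Type} [Fintype A] [DecidableEq A] [Fintype B]
    [DecidableEq B] {ρ : Matrix (A × B) (A × B) ℂ} {E E' : ℝ}
    (h : HasDistillableEntanglement ρ E) (h' : HasDistillableEntanglement ρ E') : E = E' := by
  obtain ⟨R, L, hR, hL⟩ := h
  obtain ⟨R', L', hR', hL'⟩ := h'
  refine tendsto_nhds_unique (hL.congr' ?_) hL'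
  filter_upwards [hR, hR'] with ε h1 h2
  refine tendsto_nhds_unique (h1.2.congr' ?_) h2.2
  filter_upwards [h1.1, h2.1] with n h3 h4 using h3.unique h4

/-- The entanglement cost is unique. -/
theorem HasEntanglementCost.unique {A B : Type} [Fintype A] [DecidableEq A] [Fintype B]
    [DecidableEq B] {ρ : Matrix (A × B) (A × B) ℂ} {E E' : ℝ}
    (h : HasEntanglementCost ρ E) (h' : HasEntanglementCost ρ E') : E = E' := by
  obtain ⟨R, L, hR, hL⟩ := h
  obtain ⟨R', L', hR', hL'⟩ := h'
  refine tendsto_nhds_unique (hL.congr' ?_) hL'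
  filter_upwards [hR, hR'] with ε h1 h2
  refine tendsto_nhds_unique (h1.2.congr' ?_) h2.2
  filter_upwards [h1.1, h2.1] with n h3 h4 using h3.unique h4

end

noncomputable section

open Matrix
open scoped ComplexOrder

/-! A Schmidt decomposition with squared coefficients `p` shows that both reduced states have
nonzero spectrum `p`, so both entropies equal the Shannon entropy `H` of `p`. The squared
coefficients of the `n`-th tensor power are the products of the `p i`. By equipartition, up to a
part of vanishing weight, there are at most `2 ^ (n (H + δ))` of them, each at most `2 ^ (-n (H -
δ))`.

Both converses come from one fidelity estimate, `IsLOCC.one_sub_le_traceNorm`. An LOCC map has Kraus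
operators of product form, which cannot raise Schmidt rank. A vector of Schmidt rank `r` and norm at
most one has squared overlap at most `c * r` with a vector whose squared Schmidt coefficients are at
most `c`. If `c * r` and the atypical tails are small, the output therefore stays far from the
target. This excludes every error `ε < 1`, not only small ones.

Achievability is a one-way protocol, `exists_isLOCC_traceNorm_le`: if `p` dominates a mixture of
injective relabellings of `q`, Alice measures with weights that turn each branch into a relabelled
`q`, and Bob undoes the relabelling. For distillation, `exists_mixture_injections` uses Birkhoff's
theorem to write the typical part of the product distribution as a mixture of uniform distributions
on sets of size `2 ^ m`. For dilution, translating an embedded typical set over the group `Fin m →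
Fin 2` spreads its mass evenly.

Thus for each fixed `ε` in `(0, 1)` the optimal rates already converge to `H`, and the outer limit
is that of a constant. -/

/-! ### Product Kraus operators and one-way protocols -/

/-- Every LOCC map is a trace-preserving separable map with finitely many Kraus operators. -/
theorem IsLOCC.exists_kraus {A B A' B' : Type} [Fintype A] [DecidableEq A] [Fintype B]
    [DecidableEq B] [Fintype A'] [DecidableEq A'] [Fintype B'] [DecidableEq B']
    {Λ : Matrix (A × B) (A × B) ℂ → Matrix (A' × B') (A' × B') ℂ} (h : IsLOCC A B Λ) :
    ∃ (κ : Type) (_ : Fintype κ) (K : κ → Matrix A' A ℂ) (L : κ → Matrix B' B ℂ),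
      (∀ ρ, Λ ρ = ∑ k, (K k ⊗ₖ L k) * ρ * (K k ⊗ₖ L k)ᴴ) ∧
        ∑ k, (K k ⊗ₖ L k)ᴴ * (K k ⊗ₖ L k) = 1 := by
  induction h with
  | done => exact ⟨Unit, inferInstance, fun _ => 1, fun _ => 1, by simp, by simp⟩
  | @alice A B X ι _ _ _ _ _ _ _ M hM Λ hΛ ih =>
    choose κ hκ K L h1 h2 using ih
    refine ⟨Σ i, κ i, inferInstance, fun x => K x.1 x.2 * M x.1, fun x => L x.1 x.2, ?_, ?_⟩
    · intro ρ
      rw [Fintype.sum_sigma]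
      refine Finset.sum_congr rfl fun i _ => ?_
      rw [h1]
      refine Finset.sum_congr rfl fun k _ => ?_
      have : (K i k * M i) ⊗ₖ L i k = (K i k ⊗ₖ L i k) * (M i ⊗ₖ (1 : Matrix B B ℂ)) := by
        rw [← mul_kronecker_mul, Matrix.mul_one]
      rw [this, conjTranspose_mul]
      simp only [Matrix.mul_assoc]
    · rw [Fintype.sum_sigma]
      have : ∀ i, ∑ k, ((K i k * M i) ⊗ₖ L i k)ᴴ * ((K i k * M i) ⊗ₖ L i k)
          = ((M i)ᴴ * M i) ⊗ₖ (1 : Matrix B B ℂ) := by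
        intro i
        have h3 : ∀ k, ((K i k * M i) ⊗ₖ L i k)ᴴ * ((K i k * M i) ⊗ₖ L i k) =
            (M i ⊗ₖ (1 : Matrix B B ℂ))ᴴ * ((K i k ⊗ₖ L i k)ᴴ * (K i k ⊗ₖ L i k)) *
              (M i ⊗ₖ (1 : Matrix B B ℂ)) := by
          intro k
          have : (K i k * M i) ⊗ₖ L i k = (K i k ⊗ₖ L i k) * (M i ⊗ₖ (1 : Matrix B B ℂ)) := by
            rw [← mul_kronecker_mul, Matrix.mul_one]
          rw [this, conjTranspose_mul]
          simp only [Matrix.mul_assoc]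
        simp_rw [h3]
        rw [← Matrix.sum_mul, ← Matrix.mul_sum, h2, Matrix.mul_one, conjTranspose_kronecker,
          ← mul_kronecker_mul]
        simp
      simp_rw [this]
      have h4 := congrArg (fun Y => Y ⊗ₖ (1 : Matrix B B ℂ)) hM
      simp only [one_kronecker_one] at h4
      rw [← h4]
      ext ⟨a, b⟩ ⟨a', b'⟩
      simp [Matrix.sum_apply, kroneckerMap_apply, Finset.sum_mul]
  | @bob A B X ι _ _ _ _ _ _ _ M hM Λ hΛ ih =>
    choose κ hκ K L h1 h2 using ih
    refine ⟨Σ i, κ i, inferInstance, fun x => K x.1 x.2, fun x => L x.1 x.2 * M x.1, ?_, ?_⟩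
    · intro ρ
      rw [Fintype.sum_sigma]
      refine Finset.sum_congr rfl fun i _ => ?_
      rw [h1]
      refine Finset.sum_congr rfl fun k _ => ?_
      have : K i k ⊗ₖ (L i k * M i) = (K i k ⊗ₖ L i k) * ((1 : Matrix A A ℂ) ⊗ₖ M i) := by
        rw [← mul_kronecker_mul, Matrix.mul_one]
      rw [this, conjTranspose_mul]
      simp only [Matrix.mul_assoc]
    · rw [Fintype.sum_sigma]
      have : ∀ i, ∑ k, (K i k ⊗ₖ (L i k * M i))ᴴ * (K i k ⊗ₖ (L i k * M i))
          = (1 : Matrix A A ℂ) ⊗ₖ ((M i)ᴴ * M i) := by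
        intro i
        have h3 : ∀ k, (K i k ⊗ₖ (L i k * M i))ᴴ * (K i k ⊗ₖ (L i k * M i)) =
            ((1 : Matrix A A ℂ) ⊗ₖ M i)ᴴ * ((K i k ⊗ₖ L i k)ᴴ * (K i k ⊗ₖ L i k)) *
              ((1 : Matrix A A ℂ) ⊗ₖ M i) := by
          intro k
          have : K i k ⊗ₖ (L i k * M i) = (K i k ⊗ₖ L i k) * ((1 : Matrix A A ℂ) ⊗ₖ M i) := by
            rw [← mul_kronecker_mul, Matrix.mul_one]
          rw [this, conjTranspose_mul]
          simp only [Matrix.mul_assoc]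
        simp_rw [h3]
        rw [← Matrix.sum_mul, ← Matrix.mul_sum, h2, Matrix.mul_one, conjTranspose_kronecker,
          ← mul_kronecker_mul]
        simp
      simp_rw [this]
      have h4 := congrArg (fun Y => (1 : Matrix A A ℂ) ⊗ₖ Y) hM
      simp only [one_kronecker_one] at h4
      rw [← h4]
      ext ⟨a, b⟩ ⟨a', b'⟩
      simp [Matrix.sum_apply, kroneckerMap_apply, Finset.mul_sum]

/-- LOCC maps preserve the trace. -/
theorem IsLOCC.trace_eq {A B A' B' : Type} [Fintype A] [DecidableEq A] [Fintype B]
    [DecidableEq B] [Fintype A'] [DecidableEq A'] [Fintype B'] [DecidableEq B']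
    {Λ : Matrix (A × B) (A × B) ℂ → Matrix (A' × B') (A' × B') ℂ} (h : IsLOCC A B Λ)
    (ρ : Matrix (A × B) (A × B) ℂ) : (Λ ρ).trace = ρ.trace := by
  obtain ⟨κ, _, K, L, h1, h2⟩ := h.exists_kraus
  rw [h1, trace_sum]
  simp_rw [fun k => trace_mul_comm ((K k ⊗ₖ L k) * ρ) (K k ⊗ₖ L k)ᴴ, ← Matrix.mul_assoc]
  rw [← trace_sum, ← Finset.sum_mul, h2, Matrix.one_mul]

/-- A family of operators with `∑ Mᴴ M ≤ 1` extends to a measurement. -/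
theorem exists_kraus_completion {A A' κ : Type} [Fintype A] [DecidableEq A] [Fintype A']
    [DecidableEq A'] [Nonempty A'] [Fintype κ] (M : κ → Matrix A' A ℂ)
    (hM : (1 - ∑ k, (M k)ᴴ * M k).PosSemidef) :
    ∃ R : A → Matrix A' A ℂ, ∑ i, (Sum.elim M R i)ᴴ * Sum.elim M R i = 1 := by
  obtain ⟨G, hG⟩ : ∃ G : Matrix A A ℂ, 1 - ∑ k, (M k)ᴴ * M k = Gᴴ * G := by
    classical
    open scoped MatrixOrder in
    exact CStarAlgebra.nonneg_iff_eq_star_mul_self.mp hM.nonneg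
  obtain ⟨x⟩ := ‹Nonempty A'›
  -- `G` maps into `A`, not `A'`. Each row of `G` becomes a separate outcome that prepares the fixed
  -- basis state `x`; summing over rows restores `Gᴴ * G`.
  refine ⟨fun j => Matrix.single x j (1 : ℂ) * G, ?_⟩
  have h1 : ∑ j : A, (Matrix.single x j (1 : ℂ) * G)ᴴ * (Matrix.single x j (1 : ℂ) * G) = Gᴴ * G := by
    have : ∀ j : A, (Matrix.single x j (1 : ℂ) * G)ᴴ * (Matrix.single x j (1 : ℂ) * G)
        = Gᴴ * Matrix.single j j (1 : ℂ) * G := by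
      intro j
      rw [conjTranspose_mul, Matrix.mul_assoc, ← Matrix.mul_assoc _ _ G, Matrix.mul_assoc Gᴴ]
      simp
    simp_rw [this]
    rw [← Matrix.sum_mul, ← Matrix.mul_sum, Matrix.sum_single_one, Matrix.mul_one]
  rw [Fintype.sum_sum_type]
  simp only [Sum.elim_inl, Sum.elim_inr, h1, ← hG]
  abel

/-- Alice's part `M` and Bob's part `N` of a one-way protocol, given on the successful outcomes
only, extend to an LOCC map whose remaining outcomes contribute a positive operator. -/
theorem exists_oneWay_isLOCC {A B A' B' κ : Type} [Fintype A] [DecidableEq A] [Fintype B]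
    [DecidableEq B] [Fintype A'] [DecidableEq A'] [Fintype B'] [DecidableEq B'] [Fintype κ]
    [Nonempty A'] [Nonempty B'] (M : κ → Matrix A' A ℂ) (N : κ → Matrix B' B ℂ)
    (hM : (1 - ∑ k, (M k)ᴴ * M k).PosSemidef) (hN : ∀ k, (1 - (N k)ᴴ * N k).PosSemidef) :
    ∃ Λ, IsLOCC (A' := A') (B' := B') A B Λ ∧ ∀ ρ, ρ.PosSemidef →
      (Λ ρ - ∑ k, (M k ⊗ₖ N k) * ρ * (M k ⊗ₖ N k)ᴴ).PosSemidef := by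
  obtain ⟨R, hR⟩ := exists_kraus_completion M hM
  -- On Alice's successful outcomes Bob completes `N k`; on her remaining outcomes he completes the
  -- zero operator, so he still ends in the system `B'`.
  have hN' : ∀ i : κ ⊕ A, ∃ Q : B → Matrix B' B ℂ,
      ∑ j, (Sum.elim (fun _ : Unit => Sum.elim N 0 i) Q j)ᴴ *
        Sum.elim (fun _ : Unit => Sum.elim N 0 i) Q j = 1 := by
    intro i
    apply exists_kraus_completion
    cases i with
    | inl k => simpa using hN k
    | inr a => simpa using PosSemidef.one
  choose Q hQ using hN'
  refine ⟨_, IsLOCC.alice (Sum.elim M R) hR _ fun i => IsLOCC.bob _ (hQ i) _ fun _ =>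
    IsLOCC.done, ?_⟩
  intro ρ hρ
  have key : ∀ i j, ((1 : Matrix A' A' ℂ) ⊗ₖ (Sum.elim (fun _ : Unit => Sum.elim N 0 i) (Q i) j) *
      ((Sum.elim M R i ⊗ₖ (1 : Matrix B B ℂ)) * ρ * (Sum.elim M R i ⊗ₖ (1 : Matrix B B ℂ))ᴴ) *
      ((1 : Matrix A' A' ℂ) ⊗ₖ (Sum.elim (fun _ : Unit => Sum.elim N 0 i) (Q i) j))ᴴ)
      = (Sum.elim M R i ⊗ₖ (Sum.elim (fun _ : Unit => Sum.elim N 0 i) (Q i) j)) * ρ *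
        (Sum.elim M R i ⊗ₖ (Sum.elim (fun _ : Unit => Sum.elim N 0 i) (Q i) j))ᴴ := by
    intro i j
    have : (Sum.elim M R i ⊗ₖ (Sum.elim (fun _ : Unit => Sum.elim N 0 i) (Q i) j)) =
      ((1 : Matrix A' A' ℂ) ⊗ₖ (Sum.elim (fun _ : Unit => Sum.elim N 0 i) (Q i) j)) *
        (Sum.elim M R i ⊗ₖ (1 : Matrix B B ℂ)) := by
      rw [← mul_kronecker_mul, Matrix.one_mul, Matrix.mul_one]
    rw [this, conjTranspose_mul]
    simp only [Matrix.mul_assoc]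
  simp only [key]
  have hp : ∀ i j, ((Sum.elim M R i ⊗ₖ (Sum.elim (fun _ : Unit => Sum.elim N 0 i) (Q i) j)) * ρ *
        (Sum.elim M R i ⊗ₖ (Sum.elim (fun _ : Unit => Sum.elim N 0 i) (Q i) j))ᴴ).PosSemidef :=
    fun i j => hρ.mul_mul_conjTranspose_same _
  rw [Fintype.sum_sum_type]
  simp only [Fintype.sum_sum_type, Finset.univ_unique, Finset.sum_singleton, Sum.elim_inl]
  rw [Finset.sum_add_distrib, add_assoc, add_sub_cancel_left]
  refine PosSemidef.add (posSemidef_sum _ fun k _ => posSemidef_sum _ fun j _ => ?_)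
    (posSemidef_sum _ fun i _ => PosSemidef.add ?_ (posSemidef_sum _ fun j _ => ?_))
  · exact hp (Sum.inl k) (Sum.inr j)
  · exact hp (Sum.inr i) (Sum.inl ())
  · exact hp (Sum.inr i) (Sum.inr j)

/-! ### Euclidean norms and the trace norm -/

/-- The squared Euclidean norm of a family of complex numbers. -/
def sqNorm {X : Type} [Fintype X] (v : X → ℂ) : ℝ := ∑ i, ‖v i‖ ^ 2

theorem sqNorm_nonneg {X : Type} [Fintype X] (v : X → ℂ) : 0 ≤ sqNorm v :=
  Finset.sum_nonneg fun _ _ => sq_nonneg _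

theorem star_dotProduct_self {X : Type} [Fintype X] (v : X → ℂ) :
    star v ⬝ᵥ v = (sqNorm v : ℂ) := by
  simp only [dotProduct, sqNorm, Complex.ofReal_sum, Complex.ofReal_pow, Pi.star_apply]
  refine Finset.sum_congr rfl fun i _ => ?_
  rw [mul_comm]
  exact Complex.mul_conj' (v i)

theorem sqNorm_mulVec {X Y : Type} [Fintype X] [Fintype Y] (M : Matrix Y X ℂ) (v : X → ℂ) :
    (sqNorm (M *ᵥ v) : ℂ) = star v ⬝ᵥ ((Mᴴ * M) *ᵥ v) := by
  rw [← star_dotProduct_self, star_mulVec, ← mulVec_mulVec, ← dotProduct_mulVec]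

theorem sqNorm_mulVec_of_isometry {X Y : Type} [Fintype X] [DecidableEq X] [Fintype Y]
    {M : Matrix Y X ℂ} (hM : Mᴴ * M = 1) (v : X → ℂ) : sqNorm (M *ᵥ v) = sqNorm v := by
  have := sqNorm_mulVec M v
  rw [hM, one_mulVec, star_dotProduct_self] at this
  exact_mod_cast this

theorem sum_norm_mul_norm_le {X : Type} [Fintype X] (v w : X → ℂ) :
    ∑ i, ‖v i‖ * ‖w i‖ ≤ √(sqNorm v) * √(sqNorm w) :=
  Real.sum_mul_le_sqrt_mul_sqrt _ _ _

theorem norm_dotProduct_sq_le {X : Type} [Fintype X] (v w : X → ℂ) :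
    ‖star v ⬝ᵥ w‖ ^ 2 ≤ sqNorm v * sqNorm w := by
  have h : ‖star v ⬝ᵥ w‖ ≤ √(sqNorm v) * √(sqNorm w) := by
    refine (norm_sum_le _ _).trans (le_trans (le_of_eq ?_) (sum_norm_mul_norm_le v w))
    simp
  calc _ ≤ (√(sqNorm v) * √(sqNorm w)) ^ 2 := by gcongr
    _ = _ := by rw [mul_pow, Real.sq_sqrt (sqNorm_nonneg _), Real.sq_sqrt (sqNorm_nonneg _)]

theorem trace_cfc {X : Type} [Fintype X] [DecidableEq X] {D : Matrix X X ℂ} (hD : D.IsHermitian)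
    (f : ℝ → ℝ) : (cfc f D).trace = ∑ i, (f (hD.eigenvalues i) : ℂ) := by
  rw [hD.cfc_eq, IsHermitian.cfc, Unitary.conjStarAlgAut_apply, Matrix.trace_mul_cycle]
  simp [trace]

/-- The trace norm of a Hermitian matrix is the sum of the moduli of its diagonal entries in some
orthonormal basis. -/
theorem exists_unitary_traceNorm_eq {X : Type} [Fintype X] [DecidableEq X] {D : Matrix X X ℂ}
    (hD : D.IsHermitian) :
    ∃ U : Matrix X X ℂ, U * Uᴴ = 1 ∧ traceNorm D = ∑ i, ‖(Uᴴ * D * U) i i‖ := by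
  refine ⟨hD.eigenvectorUnitary, Unitary.coe_mul_star_self _, ?_⟩
  have h1 : cfc Real.sqrt (Dᴴ * D) = cfc (fun x : ℝ => |x|) D := by
    have : Dᴴ * D = cfc (fun x : ℝ => x ^ 2) D := by
      rw [hD.eq, ← sq]
      exact (cfc_pow_id (R := ℝ) D 2 hD).symm
    rw [this, ← cfc_comp' Real.sqrt (fun x : ℝ => x ^ 2) D]
    exact cfc_congr fun x _ => Real.sqrt_sq_eq_abs x
  rw [traceNorm, h1, trace_cfc hD, Complex.re_sum]
  refine Finset.sum_congr rfl fun i _ => ?_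
  have h2 : (hD.eigenvectorUnitary : Matrix X X ℂ)ᴴ * D * (hD.eigenvectorUnitary : Matrix X X ℂ)
      = diagonal (RCLike.ofReal ∘ hD.eigenvalues) := by
    have := hD.conjStarAlgAut_star_eigenvectorUnitary
    rw [Unitary.conjStarAlgAut_apply] at this
    rw [← this]
    simp [star_eq_conjTranspose]
  rw [h2]
  simp

/-- A state that is close to `|a + b⟩⟨a + b|` in trace norm. -/
theorem traceNorm_sub_vecMulVec_le {X : Type} [Fintype X] [DecidableEq X] {J : Matrix X X ℂ}
    (hJ : J.PosSemidef) (a b : X → ℂ) (s : ℝ) :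
    traceNorm ((s : ℂ) • vecMulVec a (star a) + J - vecMulVec (a + b) (star (a + b))) ≤
      J.trace.re + |s - 1| * sqNorm a + 2 * (√(sqNorm a) * √(sqNorm b)) + sqNorm b := by
  set D := (s : ℂ) • vecMulVec a (star a) + J - vecMulVec (a + b) (star (a + b)) with hDdef
  have hDH : D.IsHermitian := by
    refine IsHermitian.sub (IsHermitian.add ?_ hJ.1) (posSemidef_vecMulVec_self_star _).1
    rw [IsHermitian, conjTranspose_smul, (posSemidef_vecMulVec_self_star a).1.eq]
    simp
  obtain ⟨U, hU, hD⟩ := exists_unitary_traceNorm_eq hDH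
  rw [hD]
  have hU' : Uᴴᴴ * Uᴴ = 1 := by rw [conjTranspose_conjTranspose, hU]
  have hJU := hJ.conjTranspose_mul_mul_same U
  have hJtr : ∑ i, ‖(Uᴴ * J * U) i i‖ = J.trace.re := by
    have : J.trace = ∑ i, (Uᴴ * J * U) i i := by
      change _ = (Uᴴ * J * U).trace
      rw [Matrix.trace_mul_cycle, hU, Matrix.one_mul]
    rw [this, Complex.re_sum]
    refine Finset.sum_congr rfl fun i _ => ?_
    have := hJU.diag_nonneg (i := i)
    have h := congrArg Complex.re (RCLike.norm_of_nonneg' this)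
    simpa using h
  have hv : ∀ c d : X → ℂ, ∀ i, (Uᴴ * vecMulVec c (star d) * U) i i =
      (Uᴴ *ᵥ c) i * star ((Uᴴ *ᵥ d) i) := by
    intro c d i
    rw [mul_vecMulVec, vecMulVec_mul, vecMulVec_apply, ← Pi.star_apply, star_mulVec,
      conjTranspose_conjTranspose]
  -- No triangle inequality for the trace norm is needed: the eigenbasis of the whole difference `D`
  -- is fixed, and its diagonal entries are expanded and bounded term by term.
  have hentry : ∀ i, (Uᴴ * D * U) i i = ((s - 1 : ℝ) : ℂ) * ((Uᴴ *ᵥ a) i * star ((Uᴴ *ᵥ a) i)) +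
      (Uᴴ * J * U) i i - ((Uᴴ *ᵥ a) i * star ((Uᴴ *ᵥ b) i) + (Uᴴ *ᵥ b) i * star ((Uᴴ *ᵥ a) i))
      - (Uᴴ *ᵥ b) i * star ((Uᴴ *ᵥ b) i) := by
    intro i
    rw [hDdef, Matrix.mul_sub, Matrix.mul_add, Matrix.sub_mul, Matrix.add_mul, Matrix.mul_smul,
      Matrix.smul_mul, Matrix.sub_apply, Matrix.add_apply, Matrix.smul_apply, hv, hv, mulVec_add]
    simp only [Pi.add_apply, star_add, smul_eq_mul]
    push_cast
    ring
  have ha := sqNorm_mulVec_of_isometry hU' a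
  have hb := sqNorm_mulVec_of_isometry hU' b
  set a' := Uᴴ *ᵥ a
  set b' := Uᴴ *ᵥ b
  have hle : ∀ i, ‖(Uᴴ * D * U) i i‖ ≤
      |s - 1| * ‖a' i‖ ^ 2 + ‖(Uᴴ * J * U) i i‖ + 2 * (‖a' i‖ * ‖b' i‖) + ‖b' i‖ ^ 2 := by
    intro i
    rw [hentry]
    refine (norm_sub_le _ _).trans (add_le_add ((norm_sub_le _ _).trans (add_le_add
      ((norm_add_le _ _).trans (add_le_add ?_ le_rfl)) ((norm_add_le _ _).trans ?_))) ?_)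
    · rw [norm_mul, Complex.norm_real, Real.norm_eq_abs, norm_mul, norm_star, sq]
    · simp only [norm_mul, norm_star]; linarith [mul_comm ‖a' i‖ ‖b' i‖]
    · simp only [norm_mul, norm_star, sq]; rfl
  refine (Finset.sum_le_sum fun i _ => hle i).trans ?_
  rw [Finset.sum_add_distrib, Finset.sum_add_distrib, Finset.sum_add_distrib, ← Finset.mul_sum,
    ← Finset.mul_sum, hJtr, ← ha, ← hb]
  have := sum_norm_mul_norm_le a' b'
  have h1 : sqNorm a' = ∑ i, ‖a' i‖ ^ 2 := rfl
  have h2 : sqNorm b' = ∑ i, ‖b' i‖ ^ 2 := rfl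
  rw [← h1, ← h2]
  linarith

/-- The expectation of a matrix in a pure state is at most its trace norm. -/
theorem norm_dotProduct_mulVec_le_traceNorm {X : Type} [Fintype X] [DecidableEq X]
    (D : Matrix X X ℂ) {v : X → ℂ} (hv : sqNorm v = 1) :
    ‖star v ⬝ᵥ (D *ᵥ v)‖ ≤ traceNorm D := by
  have hH := posSemidef_conjTranspose_mul_self D
  have htn : traceNorm D = ∑ i, √(hH.1.eigenvalues i) := by
    rw [traceNorm, trace_cfc hH.1, Complex.re_sum]
    simp
  have h0 : 0 ≤ traceNorm D := htn ▸ Finset.sum_nonneg fun _ _ => Real.sqrt_nonneg _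
  refine le_of_sq_le_sq ?_ h0
  -- Since `D` need not be Hermitian, Cauchy–Schwarz reduces the claim to the norm of `D *ᵥ v`,
  -- which is at most the largest singular value, hence at most their sum.
  have h1 := norm_dotProduct_sq_le v (D *ᵥ v)
  rw [hv, one_mul] at h1
  refine h1.trans ?_
  set U : Matrix X X ℂ := (hH.1.eigenvectorUnitary : Matrix X X ℂ) with hUdef
  have hU : Uᴴᴴ * Uᴴ = 1 := by
    rw [conjTranspose_conjTranspose]; exact Unitary.coe_mul_star_self _
  set c := Uᴴ *ᵥ v with hc
  have hcn : sqNorm c = 1 := by rw [hc, sqNorm_mulVec_of_isometry hU, hv]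
  have h2 : (sqNorm (D *ᵥ v) : ℂ) = ∑ i, ((hH.1.eigenvalues i * ‖c i‖ ^ 2 : ℝ) : ℂ) := by
    rw [sqNorm_mulVec]
    have hs := hH.1.spectral_theorem
    rw [Unitary.conjStarAlgAut_apply] at hs
    refine (congrArg (fun Y => star v ⬝ᵥ (Y *ᵥ v)) hs).trans ?_
    change star v ⬝ᵥ ((U * diagonal _ * Uᴴ) *ᵥ v) = _
    rw [← mulVec_mulVec, ← mulVec_mulVec, dotProduct_mulVec, ← hc]
    have : star v ᵥ* U = star c := by rw [hc, star_mulVec, conjTranspose_conjTranspose]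
    rw [this]
    refine Finset.sum_congr rfl fun i _ => ?_
    rw [mulVec_diagonal]
    have := Complex.mul_conj' (c i)
    simp only [Pi.star_apply, Function.comp_apply, RCLike.star_def, Complex.ofReal_mul,
      Complex.ofReal_pow, ← this, Complex.coe_algebraMap]
    change _ * ((hH.1.eigenvalues i : ℂ) * _) = _
    ring
  have h3 : sqNorm (D *ᵥ v) = ∑ i, hH.1.eigenvalues i * ‖c i‖ ^ 2 := by exact_mod_cast h2
  rw [h3]
  calc _ ≤ ∑ i, traceNorm D ^ 2 * ‖c i‖ ^ 2 := by
        refine Finset.sum_le_sum fun i _ => mul_le_mul_of_nonneg_right ?_ (sq_nonneg _)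
        rw [← Real.sq_sqrt (hH.eigenvalues_nonneg i)]
        refine pow_le_pow_left₀ (Real.sqrt_nonneg _) ?_ 2
        rw [htn]
        exact Finset.single_le_sum (f := fun i => √(hH.1.eigenvalues i))
          (fun _ _ => Real.sqrt_nonneg _) (Finset.mem_univ i)
    _ = traceNorm D ^ 2 := by rw [← Finset.mul_sum]; change _ * sqNorm c = _; rw [hcn, mul_one]

/-! ### Schmidt rank and the fidelity bound for LOCC -/

/-- The coefficient matrix of a bipartite vector. -/
def coeffMatrix {A B : Type} (v : A × B → ℂ) : Matrix A B ℂ := Matrix.of fun a b => v (a, b)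

theorem coeffMatrix_kronecker_mulVec {A B A' B' : Type} [Fintype A] [Fintype B]
    (K : Matrix A' A ℂ) (L : Matrix B' B ℂ) (v : A × B → ℂ) :
    coeffMatrix ((K ⊗ₖ L) *ᵥ v) = K * coeffMatrix v * Lᵀ := by
  ext a b
  simp only [coeffMatrix, of_apply, mulVec, dotProduct, mul_apply, kroneckerMap_apply,
    transpose_apply, Fintype.sum_prod_type, Finset.sum_mul]
  rw [Finset.sum_comm]
  refine Finset.sum_congr rfl fun x _ => Finset.sum_congr rfl fun y _ => ?_
  ring

theorem dotProduct_eq_trace {A B : Type} [Fintype A] [Fintype B] (v w : A × B → ℂ) :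
    star v ⬝ᵥ w = ((coeffMatrix v)ᴴ * coeffMatrix w).trace := by
  simp only [coeffMatrix, dotProduct, trace, diag_apply, mul_apply, conjTranspose_apply, of_apply,
    Fintype.sum_prod_type, Pi.star_apply]
  rw [Finset.sum_comm]

/-- The orthogonal projection onto the column space of a matrix. -/
theorem exists_projection_mul_eq {A B : Type} [Fintype A] [DecidableEq A] [Fintype B]
    [DecidableEq B] (X : Matrix A B ℂ) :
    ∃ Q : Matrix A A ℂ, Qᴴ = Q ∧ Q * Q = Q ∧ Q * X = X ∧ Q.trace = X.rank := by
  have hH := (posSemidef_self_mul_conjTranspose X).1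
  set U : Matrix A A ℂ := (hH.eigenvectorUnitary : Matrix A A ℂ) with hUdef
  have hU : U * Uᴴ = 1 := Unitary.coe_mul_star_self _
  have hU' : Uᴴ * U = 1 := Unitary.coe_star_mul_self _
  -- The indicator of the nonzero eigenvalues of `X * Xᴴ` gives its support projection, and `X` has
  -- the same column space.
  set d : A → ℂ := fun i => if hH.eigenvalues i = 0 then 0 else 1 with hd
  have hdd : diagonal d * diagonal d = diagonal d := by
    rw [diagonal_mul_diagonal]
    congr 1; ext i; simp only [hd]; split_ifs <;> simp
  have hs : X * Xᴴ = U * diagonal (fun i => (hH.eigenvalues i : ℂ)) * Uᴴ := by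
    have hs := hH.spectral_theorem
    rw [Unitary.conjStarAlgAut_apply] at hs
    exact hs
  have hds : diagonal d * diagonal (fun i => (hH.eigenvalues i : ℂ)) =
      diagonal (fun i => (hH.eigenvalues i : ℂ)) := by
    rw [diagonal_mul_diagonal]
    congr 1; ext i; simp only [hd]; split_ifs with h <;> simp [h]
  refine ⟨U * diagonal d * Uᴴ, ?_, ?_, ?_, ?_⟩
  · rw [conjTranspose_mul, conjTranspose_mul, conjTranspose_conjTranspose, diagonal_conjTranspose,
      Matrix.mul_assoc]
    congr 3; ext i; simp only [hd, Pi.star_apply]; split_ifs <;> simp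
  · calc U * diagonal d * Uᴴ * (U * diagonal d * Uᴴ)
        = U * (diagonal d * (Uᴴ * U) * diagonal d) * Uᴴ := by simp only [Matrix.mul_assoc]
      _ = _ := by rw [hU', Matrix.mul_one, hdd]
  · set Q := U * diagonal d * Uᴴ with hQ
    have h1 : Q * (X * Xᴴ) = X * Xᴴ := by
      rw [hs, hQ]
      calc _ = U * (diagonal d * (Uᴴ * U) * diagonal (fun i => (hH.eigenvalues i : ℂ))) * Uᴴ := by
            simp only [Matrix.mul_assoc]
        _ = _ := by rw [hU', Matrix.mul_one, hds]
    have h2 : (Q * X - X) * (Q * X - X)ᴴ = 0 := by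
      have : (Q * X - X) * (Q * X - X)ᴴ = (Q * (X * Xᴴ) - X * Xᴴ) * Qᴴ - (Q * (X * Xᴴ) - X * Xᴴ) := by
        rw [conjTranspose_sub, conjTranspose_mul]
        simp only [Matrix.mul_sub, Matrix.sub_mul, Matrix.mul_assoc]
      rw [this, h1]; simp
    exact sub_eq_zero.mp (self_mul_conjTranspose_eq_zero.mp h2)
  · rw [Matrix.trace_mul_cycle, hU', Matrix.one_mul, trace_diagonal, ← rank_self_mul_conjTranspose,
      hH.rank_eq_card_non_zero_eigs, Fintype.card_subtype, Finset.card_filter]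
    simp only [hd]
    push_cast
    refine Finset.sum_congr rfl fun i _ => ?_
    by_cases h : hH.eigenvalues i = 0 <;> simp [h]

theorem sqNorm_eq_trace {A B : Type} [Fintype A] [Fintype B] (v : A × B → ℂ) :
    (sqNorm v : ℂ) = ((coeffMatrix v)ᴴ * coeffMatrix v).trace := by
  rw [← dotProduct_eq_trace, star_dotProduct_self]

/-- The overlap of a vector of Schmidt rank at most `r` with a vector whose squared Schmidt
coefficients are at most `c`. -/
theorem norm_dotProduct_sq_le_of_rank_le {A B : Type} [Fintype A] [DecidableEq A] [Fintype B]
    [DecidableEq B] (t x : A × B → ℂ) {c r : ℝ} (hc : 0 ≤ c)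
    (ht : ((c : ℂ) • (1 : Matrix A A ℂ) - coeffMatrix t * (coeffMatrix t)ᴴ).PosSemidef)
    (hx : ((coeffMatrix x).rank : ℝ) ≤ r) :
    ‖star t ⬝ᵥ x‖ ^ 2 ≤ c * r * sqNorm x := by
  -- The projection `Q` fixes `x`, so it can be moved onto `t`. The projected `t` has squared norm
  -- `tr (Q T Tᴴ) ≤ c * tr Q`, and `tr Q` is the Schmidt rank of `x`.
  obtain ⟨Q, hQ1, hQ2, hQ3, hQ4⟩ := exists_projection_mul_eq (coeffMatrix x)
  set T := coeffMatrix t with hT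
  set t' : A × B → ℂ := fun y => (Q * T) y.1 y.2 with ht'
  have hT' : coeffMatrix t' = Q * T := rfl
  have h1 : star t ⬝ᵥ x = star t' ⬝ᵥ x := by
    rw [dotProduct_eq_trace, dotProduct_eq_trace, hT', conjTranspose_mul, hQ1, Matrix.mul_assoc,
      hQ3]
  have h2 : sqNorm t' ≤ c * r := by
    have h3 : (sqNorm t' : ℂ) = (Q * (T * Tᴴ) * Q).trace := by
      rw [sqNorm_eq_trace, hT', conjTranspose_mul, hQ1, trace_mul_comm]
      simp only [Matrix.mul_assoc]
    have h4 := (ht.conjTranspose_mul_mul_same Q).trace_nonneg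
    have h5 : (Qᴴ * ((c : ℂ) • (1 : Matrix A A ℂ) - T * Tᴴ) * Q).trace =
        ((c * (coeffMatrix x).rank - sqNorm t' : ℝ) : ℂ) := by
      rw [hQ1, Matrix.mul_sub, Matrix.sub_mul, trace_sub, ← h3, Matrix.mul_smul, Matrix.smul_mul,
        Matrix.mul_one, hQ2, trace_smul, hQ4]
      simp
    rw [h5] at h4
    have h6 : (0 : ℝ) ≤ c * (coeffMatrix x).rank - sqNorm t' := by exact_mod_cast h4
    nlinarith
  rw [h1]
  exact (norm_dotProduct_sq_le t' x).trans
    (mul_le_mul_of_nonneg_right h2 (sqNorm_nonneg x))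

theorem sum_sqNorm_kraus {X Y κ : Type} [Fintype X] [DecidableEq X] [Fintype Y] [Fintype κ]
    {K : κ → Matrix Y X ℂ} (hK : ∑ k, (K k)ᴴ * K k = 1) (v : X → ℂ) :
    ∑ k, sqNorm (K k *ᵥ v) = sqNorm v := by
  have : ((∑ k, sqNorm (K k *ᵥ v) : ℝ) : ℂ) = sqNorm v := by
    push_cast
    simp_rw [sqNorm_mulVec]
    rw [← dotProduct_sum, ← sum_mulVec, hK, one_mulVec, star_dotProduct_self]
  exact_mod_cast this

/-- The overlap splits into a low-rank main term and two tails handled by Cauchy–Schwarz; the factor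
3 is `(x + y + z)² ≤ 3 (x² + y² + z²)`. Every term on the right is a multiple of some `sqNorm`, so
that summing over Kraus operators preserves the bound. -/
theorem norm_dotProduct_add_sq_le {A B : Type} [Fintype A] [DecidableEq A] [Fintype B]
    [DecidableEq B] (t₁ t₂ w₁ w₂ : A × B → ℂ) {c r : ℝ} (hc : 0 ≤ c) (ht₁ : sqNorm t₁ ≤ 1)
    (htc : ((c : ℂ) • (1 : Matrix A A ℂ) - coeffMatrix t₁ * (coeffMatrix t₁)ᴴ).PosSemidef)
    (hr : ((coeffMatrix w₁).rank : ℝ) ≤ r) :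
    ‖star (t₁ + t₂) ⬝ᵥ (w₁ + w₂)‖ ^ 2 ≤
      3 * (c * r * sqNorm w₁ + sqNorm w₂ + sqNorm t₂ * sqNorm (w₁ + w₂)) := by
  have hsplit : star (t₁ + t₂) ⬝ᵥ (w₁ + w₂) = star t₁ ⬝ᵥ w₁ + star t₁ ⬝ᵥ w₂ +
      star t₂ ⬝ᵥ (w₁ + w₂) := by
    rw [← dotProduct_add, ← add_dotProduct, ← star_add]
  rw [hsplit]
  have h1 := norm_dotProduct_sq_le_of_rank_le t₁ w₁ hc htc hr
  have h2 : ‖star t₁ ⬝ᵥ w₂‖ ^ 2 ≤ sqNorm w₂ := by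
    refine (norm_dotProduct_sq_le _ _).trans ?_
    exact mul_le_of_le_one_left (sqNorm_nonneg _) ht₁
  have h3 := norm_dotProduct_sq_le t₂ (w₁ + w₂)
  have h4 := norm_add₃_le (a := star t₁ ⬝ᵥ w₁) (b := star t₁ ⬝ᵥ w₂) (c := star t₂ ⬝ᵥ (w₁ + w₂))
  have h5 := pow_le_pow_left₀ (norm_nonneg _) h4 2
  refine h5.trans ?_
  generalize ‖star t₁ ⬝ᵥ w₁‖ = x at *
  generalize ‖star t₁ ⬝ᵥ w₂‖ = y at *
  generalize ‖star t₂ ⬝ᵥ (w₁ + w₂)‖ = z at *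
  linarith [sq_nonneg (x - y), sq_nonneg (y - z), sq_nonneg (x - z),
    add_sq (x + y) z, add_sq x y, sub_sq x y, sub_sq y z, sub_sq x z]

/-- LOCC cannot bring a state, up to a part of small norm of Schmidt rank at most `r`, close to a
state whose squared Schmidt coefficients, up to a part of small norm, are much smaller than
`1 / r`. -/
theorem IsLOCC.one_sub_le_traceNorm {A B A' B' : Type} [Fintype A] [DecidableEq A] [Fintype B]
    [DecidableEq B] [Fintype A'] [DecidableEq A'] [Fintype B'] [DecidableEq B']
    {Λ : Matrix (A × B) (A × B) ℂ → Matrix (A' × B') (A' × B') ℂ} (h : IsLOCC A B Λ)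
    (v₁ v₂ : A × B → ℂ) (t₁ t₂ : A' × B' → ℂ) {c r : ℝ} (hc : 0 ≤ c)
    (hv₁ : sqNorm v₁ ≤ 1) (hv : sqNorm (v₁ + v₂) = 1) (ht₁ : sqNorm t₁ ≤ 1)
    (ht : sqNorm (t₁ + t₂) = 1)
    (htc : ((c : ℂ) • (1 : Matrix A' A' ℂ) - coeffMatrix t₁ * (coeffMatrix t₁)ᴴ).PosSemidef)
    (hr : ((coeffMatrix v₁).rank : ℝ) ≤ r) :
    1 - 3 * (c * r + sqNorm v₂ + sqNorm t₂) ≤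
      traceNorm (Λ (vecMulVec (v₁ + v₂) (star (v₁ + v₂))) -
        vecMulVec (t₁ + t₂) (star (t₁ + t₂))) := by
  obtain ⟨κ, _, K, L, hΛ, hKL⟩ := h.exists_kraus
  refine le_trans ?_ (norm_dotProduct_mulVec_le_traceNorm _ ht)
  set v := v₁ + v₂ with hvdef
  set t := t₁ + t₂ with htdef
  have hΛv : star t ⬝ᵥ (Λ (vecMulVec v (star v)) *ᵥ t) =
      ((∑ k, ‖star t ⬝ᵥ ((K k ⊗ₖ L k) *ᵥ v)‖ ^ 2 : ℝ) : ℂ) := by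
    rw [hΛ, sum_mulVec, dotProduct_sum]
    push_cast
    refine Finset.sum_congr rfl fun k _ => ?_
    rw [mul_vecMulVec, vecMulVec_mul, ← star_mulVec, vecMulVec_mulVec, dotProduct_smul,
      MulOpposite.smul_eq_mul_unop, MulOpposite.unop_op, ← Complex.mul_conj']
    congr 1
    rw [← Complex.star_def, star_dotProduct]
  have htt : star t ⬝ᵥ (vecMulVec t (star t) *ᵥ t) = 1 := by
    rw [vecMulVec_mulVec, dotProduct_smul, star_dotProduct_self, ht]; simp
  have hr0 : 0 ≤ r := le_trans (Nat.cast_nonneg _) hr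
  have hF : ∑ k, ‖star t ⬝ᵥ ((K k ⊗ₖ L k) *ᵥ v)‖ ^ 2 ≤ 3 * (c * r + sqNorm v₂ + sqNorm t₂) := by
    have hk : ∀ k, ‖star t ⬝ᵥ ((K k ⊗ₖ L k) *ᵥ v)‖ ^ 2 ≤
        3 * (c * r * sqNorm ((K k ⊗ₖ L k) *ᵥ v₁) + sqNorm ((K k ⊗ₖ L k) *ᵥ v₂) +
          sqNorm t₂ * sqNorm ((K k ⊗ₖ L k) *ᵥ v)) := by
      intro k
      rw [hvdef, htdef, mulVec_add]
      refine norm_dotProduct_add_sq_le _ _ _ _ hc ht₁ htc (le_trans ?_ hr)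
      -- A product operator turns the coefficient matrix `X` into `K * X * Lᵀ`, whose rank is no
      -- larger.
      rw [coeffMatrix_kronecker_mulVec]
      exact Nat.cast_le.mpr ((rank_mul_le_left _ _).trans (rank_mul_le_right _ _))
    refine (Finset.sum_le_sum fun k _ => hk k).trans ?_
    rw [← Finset.mul_sum, Finset.sum_add_distrib, Finset.sum_add_distrib, ← Finset.mul_sum,
      ← Finset.mul_sum, sum_sqNorm_kraus (K := fun k => K k ⊗ₖ L k) hKL v₁,
      sum_sqNorm_kraus (K := fun k => K k ⊗ₖ L k) hKL v₂,
      sum_sqNorm_kraus (K := fun k => K k ⊗ₖ L k) hKL v, hv]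
    have := mul_le_of_le_one_right (mul_nonneg hc hr0) hv₁
    rw [mul_one]
    gcongr
  rw [sub_mulVec, dotProduct_sub, hΛv, htt, ← Complex.ofReal_one, ← Complex.ofReal_sub,
    Complex.norm_real, Real.norm_eq_abs, abs_sub_comm]
  exact (sub_le_sub_left hF 1).trans (le_abs_self _)

/-! ### Schmidt decomposition -/

/-- The vector `∑ i, s i |i⟩|i⟩`. -/
def diagVec {I : Type} [DecidableEq I] (s : I → ℝ) : I × I → ℂ :=
  fun x => if x.1 = x.2 then (s x.1 : ℂ) else 0

/-- The vector `∑ i, s i |u i⟩|v i⟩` for the columns `u i` of `U` and `v i` of `V`. -/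
def schmidtVec {A B I : Type} [Fintype I] [DecidableEq I] (U : Matrix A I ℂ) (V : Matrix B I ℂ)
    (s : I → ℝ) : A × B → ℂ := (U ⊗ₖ V) *ᵥ diagVec s

theorem coeffMatrix_diagVec {I : Type} [DecidableEq I] (s : I → ℝ) :
    coeffMatrix (diagVec s) = diagonal fun i => (s i : ℂ) := by
  ext i j
  simp [coeffMatrix, diagVec, diagonal_apply]

theorem coeffMatrix_schmidtVec {A B I : Type} [Fintype I] [DecidableEq I] (U : Matrix A I ℂ)
    (V : Matrix B I ℂ) (s : I → ℝ) :
    coeffMatrix (schmidtVec U V s) = U * diagonal (fun i => (s i : ℂ)) * Vᵀ := by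
  rw [schmidtVec, coeffMatrix_kronecker_mulVec, coeffMatrix_diagVec]

theorem schmidtVec_apply {A B I : Type} [Fintype I] [DecidableEq I] (U : Matrix A I ℂ)
    (V : Matrix B I ℂ) (s : I → ℝ) (x : A × B) :
    schmidtVec U V s x = ∑ i, (s i : ℂ) * (U x.1 i * V x.2 i) := by
  have : schmidtVec U V s x = coeffMatrix (schmidtVec U V s) x.1 x.2 := rfl
  rw [this, coeffMatrix_schmidtVec, mul_apply]
  simp only [mul_diagonal, transpose_apply]
  exact Finset.sum_congr rfl fun i _ => by ring

theorem schmidtVec_add {A B I : Type} [Fintype I] [DecidableEq I] (U : Matrix A I ℂ)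
    (V : Matrix B I ℂ) (s t : I → ℝ) :
    schmidtVec U V (s + t) = schmidtVec U V s + schmidtVec U V t := by
  ext x
  simp [schmidtVec_apply, add_mul, Finset.sum_add_distrib]

theorem sqNorm_diagVec {I : Type} [Fintype I] [DecidableEq I] (s : I → ℝ) :
    sqNorm (diagVec s) = ∑ i, s i ^ 2 := by
  simp only [sqNorm, diagVec, Fintype.sum_prod_type]
  refine Finset.sum_congr rfl fun i _ => ?_
  rw [Finset.sum_eq_single i]
  · simp
  · intro j _ hj; simp [Ne.symm hj]
  · simp

theorem kronecker_conjTranspose_mul_self {A B I J : Type} [Fintype A] [Fintype B] [DecidableEq I]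
    [DecidableEq J] {U : Matrix A I ℂ} {V : Matrix B J ℂ} (hU : Uᴴ * U = 1) (hV : Vᴴ * V = 1) :
    (U ⊗ₖ V)ᴴ * (U ⊗ₖ V) = 1 := by
  rw [conjTranspose_kronecker, ← mul_kronecker_mul, hU, hV, one_kronecker_one]

theorem sqNorm_schmidtVec {A B I : Type} [Fintype A] [Fintype B] [Fintype I] [DecidableEq I]
    {U : Matrix A I ℂ} {V : Matrix B I ℂ} (hU : Uᴴ * U = 1) (hV : Vᴴ * V = 1) (s : I → ℝ) :
    sqNorm (schmidtVec U V s) = ∑ i, s i ^ 2 := by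
  rw [schmidtVec, sqNorm_mulVec_of_isometry (kronecker_conjTranspose_mul_self hU hV),
    sqNorm_diagVec]

/-- **Schmidt decomposition**. -/
theorem exists_schmidtVec_eq {A B : Type} [Fintype A] [DecidableEq A] [Fintype B]
    (v : A × B → ℂ) :
    ∃ (I : Type) (_ : Fintype I) (_ : DecidableEq I) (U : Matrix A I ℂ) (V : Matrix B I ℂ)
      (p : I → ℝ), (∀ i, 0 < p i) ∧ Uᴴ * U = 1 ∧ Vᴴ * V = 1 ∧ v = schmidtVec U V fun i => √(p i) := by
  set Ψ := coeffMatrix v with hΨ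
  have hP := posSemidef_self_mul_conjTranspose Ψ
  set lam := hP.1.eigenvalues with hlam
  set W : Matrix A A ℂ := (hP.1.eigenvectorUnitary : Matrix A A ℂ) with hWdef
  have hW : W * Wᴴ = 1 := Unitary.coe_mul_star_self _
  have hW' : Wᴴ * W = 1 := Unitary.coe_star_mul_self _
  have hs : Ψ * Ψᴴ = W * diagonal (fun i => (lam i : ℂ)) * Wᴴ := by
    have hs := hP.1.spectral_theorem
    rw [Unitary.conjStarAlgAut_apply] at hs
    exact hs
  have hG : (Wᴴ * Ψ) * (Wᴴ * Ψ)ᴴ = diagonal (fun i => (lam i : ℂ)) := by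
    rw [conjTranspose_mul, conjTranspose_conjTranspose]
    calc _ = Wᴴ * (Ψ * Ψᴴ) * W := by simp only [Matrix.mul_assoc]
      _ = (Wᴴ * W) * diagonal (fun i => (lam i : ℂ)) * (Wᴴ * W) := by
        rw [hs]; simp only [Matrix.mul_assoc]
      _ = _ := by rw [hW']; simp
  set G := Wᴴ * Ψ with hGdef
  have hzero : ∀ i, ¬ 0 < lam i → ∀ b, G i b = 0 := by
    intro i hi b
    have h0 : lam i = 0 := le_antisymm (not_lt.mp hi) (hP.eigenvalues_nonneg i)
    have h1 : (G * Gᴴ) i i = 0 := by rw [hG]; simp [h0]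
    rw [mul_apply] at h1
    simp only [conjTranspose_apply] at h1
    have h2 : ∑ b, ‖G i b‖ ^ 2 = 0 := by
      have : ((∑ b, ‖G i b‖ ^ 2 : ℝ) : ℂ) = 0 := by
        rw [← h1]; push_cast
        exact Finset.sum_congr rfl fun b _ => (Complex.mul_conj' _).symm
      exact_mod_cast this
    have h3 := (Finset.sum_eq_zero_iff_of_nonneg fun b _ => sq_nonneg ‖G i b‖).mp h2 b
      (Finset.mem_univ b)
    simpa using h3
  -- Only positive eigenvalues are kept: Bob's vectors are the rows of `G` divided by `√lam`, and
  -- strict positivity is needed later for logarithms and for dividing by `p`.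
  refine ⟨{i // 0 < lam i}, inferInstance, inferInstance, W.submatrix id Subtype.val,
    Matrix.of fun b i => ((1 / √(lam i.1) : ℝ) : ℂ) * G i.1 b, fun i => lam i.1, fun i => i.2,
    ?_, ?_, ?_⟩
  · ext i j
    have := congrFun (congrFun hW' i.1) j.1
    simp only [mul_apply, conjTranspose_apply, submatrix_apply, id] at this ⊢
    rw [this, one_apply, one_apply]
    simp [Subtype.ext_iff]
  · ext i j
    have := congrFun (congrFun hG j.1) i.1
    simp only [mul_apply, conjTranspose_apply, of_apply] at this ⊢
    have h1 : ∀ b, star (((1 / √(lam i.1) : ℝ) : ℂ) * G i.1 b) *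
        (((1 / √(lam j.1) : ℝ) : ℂ) * G j.1 b) =
        ((1 / √(lam i.1) : ℝ) : ℂ) * ((1 / √(lam j.1) : ℝ) : ℂ) * (G j.1 b * star (G i.1 b)) := by
      intro b
      rw [star_mul', Complex.star_def, Complex.conj_ofReal]; ring
    simp_rw [h1]
    rw [← Finset.mul_sum, this, one_apply]
    by_cases h : i = j
    · subst h
      simp only [diagonal_apply_eq, if_true]
      rw [← Complex.ofReal_mul, ← Complex.ofReal_mul, ← Complex.ofReal_one]
      congr 1
      have h2 := Real.sqrt_pos.mpr i.2
      have h3 := Real.mul_self_sqrt i.2.le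
      field_simp
      linarith
    · have h' : j.1 ≠ i.1 := fun e => h (Subtype.ext e.symm)
      simp [h', h]
  · ext ⟨a, b⟩
    have h1 : Ψ = W * G := by rw [hGdef, ← Matrix.mul_assoc, hW, Matrix.one_mul]
    have h2 : v (a, b) = Ψ a b := rfl
    rw [h2, h1, mul_apply, schmidtVec_apply]
    simp only [submatrix_apply, id, of_apply]
    rw [← Finset.sum_filter_add_sum_filter_not Finset.univ (fun i => 0 < lam i),
      Finset.sum_eq_zero (s := Finset.univ.filter fun i => ¬ 0 < lam i), add_zero,
      ← Finset.sum_subtype_eq_sum_filter]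
    · simp only [Finset.subtype_univ]
      refine Finset.sum_congr rfl fun i _ => ?_
      have h2 := Real.sqrt_pos.mpr i.2
      have h3 : ((√(lam i.1) : ℝ) : ℂ) * ((1 / √(lam i.1) : ℝ) : ℂ) = 1 := by
        rw [← Complex.ofReal_mul, ← Complex.ofReal_one]
        congr 1
        field_simp
      linear_combination (- W a i.1 * G i.1 b) * h3
    · intro i hi
      rw [hzero i (Finset.mem_filter.mp hi).2, mul_zero]

/-! ### Entropy of the reduced states -/

theorem vonNeumannEntropy_eq_sum_eigenvalues {X : Type} [Fintype X] [DecidableEq X]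
    {ρ : Matrix X X ℂ} (hρ : ρ.IsHermitian) :
    vonNeumannEntropy ρ = -∑ i, hρ.eigenvalues i * Real.logb 2 (hρ.eigenvalues i) := by
  have h1 : ρ * cfc (Real.logb 2) ρ = Unitary.conjStarAlgAut ℂ _ hρ.eigenvectorUnitary
      (diagonal fun i => ((hρ.eigenvalues i * Real.logb 2 (hρ.eigenvalues i) : ℝ) : ℂ)) := by
    rw [hρ.cfc_eq, IsHermitian.cfc]
    refine (congrArg (fun Y => Y * _) hρ.spectral_theorem).trans ?_
    rw [← map_mul, diagonal_mul_diagonal]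
    simp
  rw [vonNeumannEntropy, h1, Unitary.conjStarAlgAut_apply, Matrix.trace_mul_cycle]
  simp [trace]

/-- The entropy of `X Xᴴ`, when `Xᴴ X` is diagonal. -/
theorem vonNeumannEntropy_mul_conjTranspose {A I : Type} [Fintype A] [DecidableEq A] [Fintype I]
    [DecidableEq I] (X : Matrix A I ℂ) (p : I → ℝ)
    (hX : Xᴴ * X = diagonal fun i => (p i : ℂ)) :
    vonNeumannEntropy (X * Xᴴ) = -∑ i, p i * Real.logb 2 (p i) := by
  have hH := isHermitian_mul_conjTranspose_self X
  rw [vonNeumannEntropy_eq_sum_eigenvalues hH, neg_inj]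
  -- The characteristic polynomials of `X * Xᴴ` and `Xᴴ * X` agree up to powers of the variable; the
  -- extra zero roots contribute `0 * logb 2 0 = 0`.
  have h1 := charpoly_mul_comm' X Xᴴ
  rw [hX, charpoly_diagonal] at h1
  have h2 := congrArg (fun q => (q.roots.map fun z : ℂ => z.re * Real.logb 2 z.re).sum) h1
  have hne : (∏ i, (Polynomial.X - Polynomial.C ((p i : ℂ)))) ≠ 0 :=
    Finset.prod_ne_zero_iff.mpr fun i _ => Polynomial.X_sub_C_ne_zero _
  have hr : (∏ i, (Polynomial.X - Polynomial.C ((p i : ℂ)))).roots =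
      Finset.univ.val.map fun i => (p i : ℂ) := by
    rw [← Polynomial.roots_multiset_prod_X_sub_C (Finset.univ.val.map fun i => (p i : ℂ)),
      Multiset.map_map]
    rfl
  rw [Polynomial.roots_mul (mul_ne_zero (pow_ne_zero _ Polynomial.X_ne_zero)
      (charpoly_monic _).ne_zero),
    Polynomial.roots_mul (mul_ne_zero (pow_ne_zero _ Polynomial.X_ne_zero) hne),
    hH.roots_charpoly_eq_eigenvalues, hr] at h2
  simpa [Multiset.map_nsmul, Multiset.sum_nsmul] using h2

theorem vonNeumannEntropy_of_eq {A B I : Type} [Fintype A] [DecidableEq A] [Fintype B] [Fintype I]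
    [DecidableEq I] {U : Matrix A I ℂ} {V : Matrix B I ℂ} (hU : Uᴴ * U = 1) (hV : Vᴴ * V = 1)
    {p : I → ℝ} (hp : ∀ i, 0 ≤ p i) {Ψ : Matrix A B ℂ}
    (hΨ : Ψ = U * diagonal (fun i => ((√(p i) : ℝ) : ℂ)) * Vᵀ) :
    vonNeumannEntropy (Ψ * Ψᴴ) = -∑ i, p i * Real.logb 2 (p i) := by
  set D := diagonal (fun i => ((√(p i) : ℝ) : ℂ)) with hD
  have hDD : Dᴴ = D := by
    rw [hD, diagonal_conjTranspose]; congr 1; ext i; simp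
  have hV' : Vᵀ * Vᵀᴴ = 1 := by
    have : Vᵀᴴ = Vᴴᵀ := rfl
    rw [this, ← transpose_mul, hV, transpose_one]
  have h1 : Ψ * Ψᴴ = (U * D) * (U * D)ᴴ := by
    rw [hΨ, conjTranspose_mul (U * D), Matrix.mul_assoc, ← Matrix.mul_assoc Vᵀ, hV',
      Matrix.one_mul]
  rw [h1]
  apply vonNeumannEntropy_mul_conjTranspose
  rw [conjTranspose_mul, hDD, Matrix.mul_assoc, ← Matrix.mul_assoc Uᴴ, hU, Matrix.one_mul, hD,
    diagonal_mul_diagonal]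
  congr 1; ext i
  rw [← Complex.ofReal_mul, Real.mul_self_sqrt (hp i)]

theorem vonNeumannEntropy_reducedA {A B I : Type} [Fintype A] [DecidableEq A] [Fintype B]
    [Fintype I] [DecidableEq I] {U : Matrix A I ℂ} {V : Matrix B I ℂ} (hU : Uᴴ * U = 1)
    (hV : Vᴴ * V = 1) {p : I → ℝ} (hp : ∀ i, 0 ≤ p i) {ψ : EuclideanSpace ℂ (A × B)}
    (hψ : ⇑ψ = schmidtVec U V fun i => √(p i)) :
    vonNeumannEntropy (reducedA (pureState ψ)) = -∑ i, p i * Real.logb 2 (p i) := by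
  rw [← vonNeumannEntropy_of_eq hU hV hp (coeffMatrix_schmidtVec U V fun i => √(p i)), ← hψ]
  rfl

/-- Transposing the coefficient matrix exchanges the two parties and leaves the Schmidt coefficients
unchanged. -/
theorem vonNeumannEntropy_reducedB {A B I : Type} [Fintype A] [Fintype B] [DecidableEq B]
    [Fintype I] [DecidableEq I] {U : Matrix A I ℂ} {V : Matrix B I ℂ} (hU : Uᴴ * U = 1)
    (hV : Vᴴ * V = 1) {p : I → ℝ} (hp : ∀ i, 0 ≤ p i) {ψ : EuclideanSpace ℂ (A × B)}
    (hψ : ⇑ψ = schmidtVec U V fun i => √(p i)) :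
    vonNeumannEntropy (reducedB (pureState ψ)) = -∑ i, p i * Real.logb 2 (p i) := by
  have h : (coeffMatrix ⇑ψ)ᵀ = V * diagonal (fun i => ((√(p i) : ℝ) : ℂ)) * Uᵀ := by
    rw [hψ, coeffMatrix_schmidtVec, transpose_mul, transpose_mul, diagonal_transpose,
      transpose_transpose, Matrix.mul_assoc]
  rw [← vonNeumannEntropy_of_eq hV hU hp h]
  rfl

/-! ### Tensor powers of Schmidt decompositions -/

/-- The tensor power of a matrix. -/
def matrixPow {A I : Type} (n : ℕ) (U : Matrix A I ℂ) : Matrix (Fin n → A) (Fin n → I) ℂ :=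
  Matrix.of fun a x => ∏ i, U (a i) (x i)

theorem matrixPow_conjTranspose_mul_self {A I : Type} [Fintype A] [DecidableEq I] (n : ℕ)
    {U : Matrix A I ℂ} (hU : Uᴴ * U = 1) : (matrixPow n U)ᴴ * matrixPow n U = 1 := by
  ext x y
  simp only [matrixPow, mul_apply, conjTranspose_apply, of_apply, star_prod]
  simp_rw [← Finset.prod_mul_distrib]
  rw [← Fintype.prod_sum fun (i : Fin n) a => star (U a (x i)) * U a (y i)]
  have : ∀ i, ∑ a, star (U a (x i)) * U a (y i) = (1 : Matrix I I ℂ) (x i) (y i) := by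
    intro i; rw [← hU, mul_apply]; rfl
  simp_rw [this, one_apply]
  by_cases h : x = y
  · simp [h]
  · obtain ⟨i, hi⟩ := Function.ne_iff.mp h
    rw [if_neg h]
    exact Finset.prod_eq_zero (Finset.mem_univ i) (if_neg hi)

theorem tensorPower_pureState {A B I : Type} [Fintype I] [DecidableEq I] {U : Matrix A I ℂ}
    {V : Matrix B I ℂ} {s : I → ℝ} {ψ : EuclideanSpace ℂ (A × B)} (hψ : ⇑ψ = schmidtVec U V s)
    (n : ℕ) : tensorPower n (pureState ψ) =
      vecMulVec (schmidtVec (matrixPow n U) (matrixPow n V) fun x => ∏ i, s (x i))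
        (star (schmidtVec (matrixPow n U) (matrixPow n V) fun x => ∏ i, s (x i))) := by
  have h : ∀ x : (Fin n → A) × (Fin n → B), ∏ i, ψ (x.1 i, x.2 i) =
      schmidtVec (matrixPow n U) (matrixPow n V) (fun x => ∏ i, s (x i)) x := by
    intro x
    simp only [hψ, schmidtVec_apply, matrixPow, of_apply]
    rw [Fintype.prod_sum fun (i : Fin n) j => (s j : ℂ) * (U (x.1 i) j * V (x.2 i) j)]
    simp [Finset.prod_mul_distrib]
  ext x y
  rw [vecMulVec_apply, Pi.star_apply, ← h, ← h, star_prod, ← Finset.prod_mul_distrib]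
  rfl

theorem eprPair_eq : ⇑eprPair =
    schmidtVec (1 : Matrix (Fin 2) (Fin 2) ℂ) (1 : Matrix (Fin 2) (Fin 2) ℂ)
      fun _ => √(1 / 2) := by
  ext x
  simp only [eprPair, schmidtVec, one_kronecker_one, one_mulVec, diagVec]
  simp

/-! ### Typical sequences -/

theorem Fin.sum_pi_succ {I : Type} [Fintype I] {n : ℕ} (G : (Fin (n + 1) → I) → ℝ) :
    ∑ x, G x = ∑ a, ∑ y : Fin n → I, G (Fin.cons a y) := by
  rw [← Fintype.sum_prod_type']
  exact (Fintype.sum_equiv (Fin.consEquiv fun _ => I) _ _ fun _ => rfl).symm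

theorem sum_prod_eq_one {I : Type} [Fintype I] {p : I → ℝ} (hp : ∑ i, p i = 1) (n : ℕ) :
    ∑ x : Fin n → I, ∏ i, p (x i) = 1 := by
  rw [← Fintype.prod_sum fun (_ : Fin n) j => p j]
  simp [hp]

/-- Independent centred variables have a centred sum; this kills the cross term in the variance
computation. -/
theorem sum_prod_mul_sum {I : Type} [Fintype I] {p f : I → ℝ} (hp : ∑ i, p i = 1)
    (hf : ∑ i, p i * f i = 0) (n : ℕ) :
    ∑ x : Fin n → I, (∏ i, p (x i)) * ∑ i, f (x i) = 0 := by
  induction n with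
  | zero => simp
  | succ n ih =>
    rw [Fin.sum_pi_succ]
    simp only [Fin.prod_univ_succ, Fin.sum_univ_succ, Fin.cons_zero, Fin.cons_succ]
    have h : ∀ a, ∑ y : Fin n → I, p a * (∏ i, p (y i)) * (f a + ∑ i, f (y i)) = p a * f a := by
      intro a
      calc _ = p a * f a * (∑ y : Fin n → I, ∏ i, p (y i)) +
            p a * ∑ y : Fin n → I, (∏ i, p (y i)) * ∑ i, f (y i) := by
            rw [Finset.mul_sum, Finset.mul_sum, ← Finset.sum_add_distrib]
            exact Finset.sum_congr rfl fun y _ => by ring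
        _ = _ := by rw [sum_prod_eq_one hp, ih]; ring
    simp_rw [h, hf]

/-- The variance of a sum of independent identically distributed random variables. -/
theorem sum_prod_mul_sum_sq {I : Type} [Fintype I] {p f : I → ℝ} (hp : ∑ i, p i = 1)
    (hf : ∑ i, p i * f i = 0) (n : ℕ) :
    ∑ x : Fin n → I, (∏ i, p (x i)) * (∑ i, f (x i)) ^ 2 = n * ∑ i, p i * f i ^ 2 := by
  induction n with
  | zero => simp
  | succ n ih =>
    rw [Fin.sum_pi_succ]
    simp only [Fin.prod_univ_succ, Fin.sum_univ_succ, Fin.cons_zero, Fin.cons_succ]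
    have h : ∀ a, ∑ y : Fin n → I, p a * (∏ i, p (y i)) * (f a + ∑ i, f (y i)) ^ 2 =
        p a * f a ^ 2 + p a * (n * ∑ i, p i * f i ^ 2) := by
      intro a
      calc _ = p a * f a ^ 2 * (∑ y : Fin n → I, ∏ i, p (y i)) +
            2 * (p a * f a) * (∑ y : Fin n → I, (∏ i, p (y i)) * ∑ i, f (y i)) +
            p a * ∑ y : Fin n → I, (∏ i, p (y i)) * (∑ i, f (y i)) ^ 2 := by
            rw [Finset.mul_sum, Finset.mul_sum, Finset.mul_sum, ← Finset.sum_add_distrib,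
              ← Finset.sum_add_distrib]
            exact Finset.sum_congr rfl fun y _ => by ring
        _ = _ := by rw [sum_prod_eq_one hp, sum_prod_mul_sum hp hf, ih]; ring
    simp_rw [h]
    rw [Finset.sum_add_distrib, ← Finset.sum_mul, hp]
    push_cast
    ring

/-- The sequences whose probability is `2 ^ (-n (H ± δ))`. -/
def typicalSet {I : Type} [Fintype I] (p : I → ℝ) (H δ : ℝ) (n : ℕ) : Finset (Fin n → I) :=
  open scoped Classical in
  Finset.univ.filter fun x => (2 : ℝ) ^ (-(n * (H + δ))) ≤ ∏ i, p (x i) ∧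
    ∏ i, p (x i) ≤ (2 : ℝ) ^ (-(n * (H - δ)))

theorem mem_typicalSet {I : Type} [Fintype I] {p : I → ℝ} {H δ : ℝ} {n : ℕ} {x : Fin n → I} :
    x ∈ typicalSet p H δ n ↔ (2 : ℝ) ^ (-(n * (H + δ))) ≤ ∏ i, p (x i) ∧
      ∏ i, p (x i) ≤ (2 : ℝ) ^ (-(n * (H - δ))) := by
  simp [typicalSet]

/-- Each typical sequence has mass at least `2 ^ (-(n * (H + δ)))`, and the total mass is at most
one. -/
theorem card_typicalSet_le {I : Type} [Fintype I] {p : I → ℝ} (hp0 : ∀ i, 0 < p i)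
    (hp : ∑ i, p i = 1) (H δ : ℝ) (n : ℕ) :
    ((typicalSet p H δ n).card : ℝ) ≤ (2 : ℝ) ^ (n * (H + δ)) := by
  have h1 : ((typicalSet p H δ n).card : ℝ) * (2 : ℝ) ^ (-(n * (H + δ))) ≤ 1 := by
    rw [← nsmul_eq_mul]
    calc _ ≤ ∑ x ∈ typicalSet p H δ n, ∏ i, p (x i) :=
          Finset.card_nsmul_le_sum _ _ _ fun x hx => (mem_typicalSet.mp hx).1
      _ ≤ ∑ x : Fin n → I, ∏ i, p (x i) :=
          Finset.sum_le_sum_of_subset_of_nonneg (Finset.subset_univ _)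
            fun x _ _ => Finset.prod_nonneg fun i _ => (hp0 _).le
      _ = 1 := sum_prod_eq_one hp n
  rw [Real.rpow_neg two_pos.le] at h1
  rwa [← div_eq_mul_inv, div_le_one (by positivity)] at h1

/-- **Asymptotic equipartition property**. -/
theorem eventually_one_sub_sum_typicalSet_le {I : Type} [Fintype I] {p : I → ℝ}
    (hp0 : ∀ i, 0 < p i) (hp : ∑ i, p i = 1) {H δ η : ℝ}
    (hH : H = -∑ i, p i * Real.logb 2 (p i)) (hδ : 0 < δ) (hη : 0 < η) :
    ∀ᶠ n : ℕ in atTop, 1 - ∑ x ∈ typicalSet p H δ n, ∏ i, p (x i) ≤ η := by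
  -- Chebyshev's inequality for the centred log-probability `f`: atypical sequences have `|∑ f| ≥ n
  -- δ`, while the variance of the sum is `n V`, so their mass is at most `V / (n δ²)`.
  set f : I → ℝ := fun i => Real.logb 2 (p i) + H with hfdef
  have hf : ∑ i, p i * f i = 0 := by
    simp only [hfdef, mul_add, Finset.sum_add_distrib, ← Finset.sum_mul, hp, hH]; ring
  set V := ∑ i, p i * f i ^ 2 with hV
  have hV0 : 0 ≤ V := Finset.sum_nonneg fun i _ => mul_nonneg (hp0 i).le (sq_nonneg _)
  obtain ⟨N, hN⟩ := exists_nat_gt (V / (δ ^ 2 * η))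
  filter_upwards [eventually_ge_atTop (max N 1)] with n hn
  have hn1 : (1 : ℝ) ≤ n := by exact_mod_cast (le_max_right _ _).trans hn
  have hnN : V / (δ ^ 2 * η) ≤ n := hN.le.trans (by exact_mod_cast (le_max_left _ _).trans hn)
  classical
  rw [← sum_prod_eq_one hp n, ← Finset.sum_compl_add_sum (typicalSet p H δ n), add_sub_cancel_right]
  have hlog : ∀ x : Fin n → I, ∑ i, f (x i) = Real.logb 2 (∏ i, p (x i)) + n * H := by
    intro x
    rw [Real.logb_prod _ _ fun i _ => (hp0 _).ne']
    simp [hfdef, Finset.sum_add_distrib]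
  have hbad : ∀ x ∈ (typicalSet p H δ n)ᶜ, (n * δ) ^ 2 ≤ (∑ i, f (x i)) ^ 2 := by
    intro x hx
    rw [Finset.mem_compl, mem_typicalSet, not_and_or, not_le, not_le] at hx
    have hP : 0 < ∏ i, p (x i) := Finset.prod_pos fun i _ => hp0 _
    rw [hlog, sq_le_sq, abs_of_nonneg (by positivity), le_abs]
    rcases hx with hx | hx
    · right
      rw [← Real.logb_lt_iff_lt_rpow one_lt_two hP] at hx
      linarith
    · left
      rw [← Real.lt_logb_iff_rpow_lt one_lt_two hP] at hx
      linarith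
  have h1 : (n * δ) ^ 2 * ∑ x ∈ (typicalSet p H δ n)ᶜ, ∏ i, p (x i) ≤ n * V := by
    rw [hV, ← sum_prod_mul_sum_sq hp hf, Finset.mul_sum]
    calc _ ≤ ∑ x ∈ (typicalSet p H δ n)ᶜ, (∏ i, p (x i)) * (∑ i, f (x i)) ^ 2 := by
          refine Finset.sum_le_sum fun x hx => ?_
          rw [mul_comm]
          exact mul_le_mul_of_nonneg_left (hbad x hx) (Finset.prod_nonneg fun i _ => (hp0 _).le)
      _ ≤ _ := Finset.sum_le_sum_of_subset_of_nonneg (Finset.subset_univ _)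
            fun x _ _ => mul_nonneg (Finset.prod_nonneg fun i _ => (hp0 _).le) (sq_nonneg _)
  rw [div_le_iff₀ (by positivity)] at hnN
  have h2 : (n * δ) ^ 2 * ∑ x ∈ (typicalSet p H δ n)ᶜ, ∏ i, p (x i) ≤ (n * δ) ^ 2 * η := by
    refine h1.trans ((mul_le_mul_of_nonneg_left hnN (by positivity)).trans (le_of_eq (by ring)))
  exact le_of_mul_le_mul_left h2 (by positivity)

/-! ### One-way protocols in terms of Schmidt coefficients -/

/-- The difference is `c (1 - U Uᴴ) + U diag(c - d) Uᴴ`, and `1 - U Uᴴ` is a projection. -/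
theorem posSemidef_smul_one_sub {A I : Type} [Fintype A] [DecidableEq A] [Fintype I]
    [DecidableEq I] {U : Matrix A I ℂ} (hU : Uᴴ * U = 1) {c : ℝ} (hc : 0 ≤ c) {d : I → ℝ}
    (hd : ∀ i, d i ≤ c) :
    ((c : ℂ) • (1 : Matrix A A ℂ) - U * diagonal (fun i => (d i : ℂ)) * Uᴴ).PosSemidef := by
  have h1 : (1 - U * Uᴴ).PosSemidef := by
    have : 1 - U * Uᴴ = (1 - U * Uᴴ)ᴴ * (1 - U * Uᴴ) := by
      rw [conjTranspose_sub, conjTranspose_mul, conjTranspose_conjTranspose, conjTranspose_one]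
      have : U * Uᴴ * (U * Uᴴ) = U * Uᴴ := by
        rw [Matrix.mul_assoc, ← Matrix.mul_assoc Uᴴ, hU, Matrix.one_mul]
      rw [Matrix.mul_sub, Matrix.sub_mul, Matrix.sub_mul, this]
      simp
    rw [this]
    exact posSemidef_conjTranspose_mul_self _
  have h2 : (diagonal (fun i => ((c - d i : ℝ) : ℂ))).PosSemidef := by
    refine PosSemidef.diagonal fun i => ?_
    have := sub_nonneg.mpr (hd i)
    exact Complex.zero_le_real.mpr this
  have h3 : (c : ℂ) • (1 : Matrix A A ℂ) - U * diagonal (fun i => (d i : ℂ)) * Uᴴ =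
      (c : ℂ) • (1 - U * Uᴴ) + U * diagonal (fun i => ((c - d i : ℝ) : ℂ)) * Uᴴ := by
    have : diagonal (fun i => ((c - d i : ℝ) : ℂ)) =
        (c : ℂ) • (1 : Matrix I I ℂ) - diagonal (fun i => (d i : ℂ)) := by
      ext i j
      by_cases h : i = j
      · subst h; simp
      · simp [h]
    rw [this, Matrix.mul_sub, Matrix.sub_mul, smul_sub, Matrix.mul_smul, Matrix.smul_mul,
      Matrix.mul_one]
    abel
  rw [h3]
  exact (h1.smul (by exact_mod_cast hc)).add (h2.mul_mul_conjTranspose_same U)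

theorem isometry_conj_mul {A I A' J : Type} [Fintype A] [Fintype I] [Fintype A'] [Fintype J]
    [DecidableEq J] (U : Matrix A I ℂ) {U' : Matrix A' J ℂ} (hU' : U'ᴴ * U' = 1)
    (m : Matrix J I ℂ) : (U' * m * Uᴴ)ᴴ * (U' * m * Uᴴ) = U * (mᴴ * m) * Uᴴ := by
  simp only [conjTranspose_mul, conjTranspose_conjTranspose]
  calc _ = U * (mᴴ * (U'ᴴ * U') * m) * Uᴴ := by simp only [Matrix.mul_assoc]
    _ = _ := by rw [hU', Matrix.mul_one]

/-- The matrix of a weighted partial relabelling `e j ↦ j`. -/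
def relabel {I J : Type} [DecidableEq I] (e : J → I) (g : J → ℝ) : Matrix J I ℂ :=
  Matrix.of fun j i => if e j = i then (g j : ℂ) else 0

theorem relabel_conjTranspose_mul_self {I J : Type} [DecidableEq I] [Fintype J]
    (e : J → I) (g : J → ℝ) : (relabel e g)ᴴ * relabel e g =
      diagonal fun i => ((∑ j, if e j = i then g j ^ 2 else 0 : ℝ) : ℂ) := by
  ext i i'
  simp only [relabel, mul_apply, conjTranspose_apply, of_apply, diagonal_apply]
  split_ifs with h
  · subst h
    push_cast
    refine Finset.sum_congr rfl fun j _ => ?_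
    split_ifs <;> simp [sq]
  · refine Finset.sum_eq_zero fun j _ => ?_
    split_ifs with h1 h2
    · exact absurd (h1.symm.trans h2) h
    all_goals simp

theorem relabel_kronecker_mulVec_diagVec {I J : Type} [Fintype I] [DecidableEq I] [DecidableEq J]
    {e : J → I} (he : Function.Injective e) (g g' : J → ℝ) (s : I → ℝ) :
    (relabel e g ⊗ₖ relabel e g') *ᵥ diagVec s = diagVec fun j => g j * s (e j) * g' j := by
  have h : coeffMatrix ((relabel e g ⊗ₖ relabel e g') *ᵥ diagVec s) =
      coeffMatrix (diagVec fun j => g j * s (e j) * g' j) := by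
    rw [coeffMatrix_kronecker_mulVec, coeffMatrix_diagVec, coeffMatrix_diagVec]
    ext j j'
    simp only [mul_apply, relabel, of_apply, transpose_apply, diagonal_apply]
    rw [Finset.sum_eq_single (e j)]
    · by_cases hj : j = j'
      · subst hj; simp
      · have : e j' ≠ e j := fun h => hj (he h).symm
        simp [hj, this]
    · intro i _ hi; simp [Ne.symm hi]
    · simp
  ext ⟨j, j'⟩
  exact congrFun (congrFun h j) j'

/-- If the squared Schmidt coefficients `p` of a state dominate a mixture of relabellings of `q`,
then LOCC transforms the state into one with squared Schmidt coefficients `q`. -/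
theorem exists_isLOCC_traceNorm_le {A B A' B' I J κ : Type} [Fintype A] [DecidableEq A] [Fintype B]
    [DecidableEq B] [Fintype A'] [DecidableEq A'] [Fintype B'] [DecidableEq B'] [Fintype I]
    [DecidableEq I] [Fintype J] [DecidableEq J] [Fintype κ] [Nonempty A'] [Nonempty B']
    {U : Matrix A I ℂ} {V : Matrix B I ℂ} {U' : Matrix A' J ℂ} {V' : Matrix B' J ℂ}
    (hU : Uᴴ * U = 1) (hV : Vᴴ * V = 1) (hU' : U'ᴴ * U' = 1) (hV' : V'ᴴ * V' = 1)
    {p : I → ℝ} {q : J → ℝ} (hp : ∀ i, 0 < p i) (hq : ∀ j, 0 ≤ q j) {w : κ → ℝ} (hw : ∀ k, 0 ≤ w k)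
    {e : κ → J → I} (he : ∀ k, Function.Injective (e k))
    (h : ∀ i, ∑ k, w k * ∑ j, (if e k j = i then q j else 0) ≤ p i) (b : A' × B' → ℂ) :
    ∃ Λ, IsLOCC (A' := A') (B' := B') A B Λ ∧
      traceNorm (Λ (vecMulVec (schmidtVec U V fun i => √(p i))
          (star (schmidtVec U V fun i => √(p i)))) -
        vecMulVec (schmidtVec U' V' (fun j => √(q j)) + b)
          (star (schmidtVec U' V' (fun j => √(q j)) + b))) ≤
      (∑ i, p i - (∑ k, w k) * ∑ j, q j) + |∑ k, w k - 1| * ∑ j, q j +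
        2 * (√(∑ j, q j) * √(sqNorm b)) + sqNorm b := by
  set v := schmidtVec U V fun i => √(p i) with hv
  set a := schmidtVec U' V' fun j => √(q j) with ha
  have hvn : sqNorm v = ∑ i, p i := by
    rw [hv, sqNorm_schmidtVec hU hV]
    exact Finset.sum_congr rfl fun i _ => Real.sq_sqrt (hp i).le
  have han : sqNorm a = ∑ j, q j := by
    rw [ha, sqNorm_schmidtVec hU' hV']
    exact Finset.sum_congr rfl fun i _ => Real.sq_sqrt (hq i)
  -- Alice's weight turns the amplitude `√(p (e k j))` into `√(w k * q j)`; Bob's operator `n k`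
  -- only relabels. The hypothesis `h` says exactly that Alice's operators satisfy `∑ Mᴴ M ≤ 1`.
  set m : κ → Matrix J I ℂ := fun k => relabel (e k) fun j => √(w k * q j / p (e k j)) with hm
  set n : κ → Matrix J I ℂ := fun k => relabel (e k) fun _ => 1 with hn
  have hM : (1 - ∑ k, (U' * m k * Uᴴ)ᴴ * (U' * m k * Uᴴ)).PosSemidef := by
    have h1 : ∑ k, (U' * m k * Uᴴ)ᴴ * (U' * m k * Uᴴ) = U * diagonal (fun i =>
        ((∑ k, ∑ j, (if e k j = i then √(w k * q j / p (e k j)) ^ 2 else 0) : ℝ) : ℂ)) * Uᴴ := by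
      simp_rw [isometry_conj_mul U hU', hm, relabel_conjTranspose_mul_self]
      rw [← Matrix.sum_mul, ← Matrix.mul_sum]
      congr 2
      ext i j
      rw [Matrix.sum_apply]
      simp only [diagonal_apply]
      split_ifs <;> simp
    rw [h1]
    have h2 := posSemidef_smul_one_sub (c := 1) hU zero_le_one (d := fun i =>
        ∑ k, ∑ j, (if e k j = i then √(w k * q j / p (e k j)) ^ 2 else 0)) fun i => by
      have h3 : ∑ k, ∑ j, (if e k j = i then √(w k * q j / p (e k j)) ^ 2 else 0) =
          (∑ k, w k * ∑ j, (if e k j = i then q j else 0)) / p i := by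
        rw [Finset.sum_div]
        refine Finset.sum_congr rfl fun k _ => ?_
        rw [Finset.mul_sum, Finset.sum_div]
        refine Finset.sum_congr rfl fun j _ => ?_
        split_ifs with hj
        · rw [hj, Real.sq_sqrt (div_nonneg (mul_nonneg (hw k) (hq j)) (hp i).le)]
        · simp
      rw [h3, div_le_one (hp i)]
      exact h i
    simpa using h2
  have hN : ∀ k, (1 - (V' * n k * Vᴴ)ᴴ * (V' * n k * Vᴴ)).PosSemidef := by
    intro k
    rw [isometry_conj_mul V hV', hn, relabel_conjTranspose_mul_self]
    have h2 := posSemidef_smul_one_sub (c := 1) hV zero_le_one (d := fun i =>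
        ∑ j, (if e k j = i then (1 : ℝ) ^ 2 else 0)) fun i => by
      by_cases hi : ∃ j, e k j = i
      · obtain ⟨j, rfl⟩ := hi
        rw [Finset.sum_eq_single j]
        · simp
        · intro j' _ hj'
          rw [if_neg fun h => hj' (he k h)]
        · simp
      · rw [Finset.sum_eq_zero fun j _ => if_neg fun h => hi ⟨j, h⟩]
        exact zero_le_one
    simpa using h2
  obtain ⟨Λ, hΛ, hpos⟩ := exists_oneWay_isLOCC (fun k => U' * m k * Uᴴ) (fun k => V' * n k * Vᴴ)
    hM hN
  refine ⟨Λ, hΛ, ?_⟩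
  have hJ := hpos _ (posSemidef_vecMulVec_self_star v)
  -- All successful outcomes leave the same vector `a`, up to the amplitude `√(w k)`, so averaging
  -- over them keeps the state pure.
  have hout : ∀ k, ((U' * m k * Uᴴ) ⊗ₖ (V' * n k * Vᴴ)) *ᵥ v = ((√(w k) : ℝ) : ℂ) • a := by
    intro k
    rw [hv, ha, schmidtVec, schmidtVec, mulVec_mulVec, ← mul_kronecker_mul, Matrix.mul_assoc _ Uᴴ,
      Matrix.mul_assoc _ Vᴴ, hU, hV, Matrix.mul_one, Matrix.mul_one, mul_kronecker_mul,
      ← mulVec_mulVec, hm, hn, relabel_kronecker_mulVec_diagVec (he k), ← mulVec_smul]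
    congr 1
    ext ⟨j, j'⟩
    simp only [diagVec, Pi.smul_apply, smul_eq_mul]
    split_ifs
    · rw [← Complex.ofReal_mul]
      congr 1
      rw [mul_one, ← Real.sqrt_mul (div_nonneg (mul_nonneg (hw k) (hq j)) (hp _).le),
        div_mul_cancel₀ _ (hp _).ne', Real.sqrt_mul (hw k)]
    · simp
  have hsum : ∑ k, ((U' * m k * Uᴴ) ⊗ₖ (V' * n k * Vᴴ)) * vecMulVec v (star v) *
      ((U' * m k * Uᴴ) ⊗ₖ (V' * n k * Vᴴ))ᴴ =
      ((∑ k, w k : ℝ) : ℂ) • vecMulVec a (star a) := by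
    push_cast
    rw [Finset.sum_smul]
    refine Finset.sum_congr rfl fun k _ => ?_
    rw [mul_vecMulVec, vecMulVec_mul, ← star_mulVec, hout]
    ext x y
    simp only [vecMulVec_apply, Pi.smul_apply, Pi.star_apply, smul_eq_mul, Matrix.smul_apply,
      star_mul', Complex.star_def, Complex.conj_ofReal]
    have := Real.mul_self_sqrt (hw k)
    have h' : ((√(w k) : ℝ) : ℂ) * ((√(w k) : ℝ) : ℂ) = (w k : ℂ) := by exact_mod_cast this
    rw [← h']
    ring
  rw [hsum] at hJ
  have key := traceNorm_sub_vecMulVec_le hJ a b (∑ k, w k)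
  rw [add_sub_cancel] at key
  refine key.trans (le_of_eq ?_)
  rw [trace_sub, hΛ.trace_eq, trace_smul, trace_vecMulVec, trace_vecMulVec, dotProduct_comm v,
    dotProduct_comm a, star_dotProduct_self, star_dotProduct_self, hvn, han]
  simp only [smul_eq_mul, ← Complex.ofReal_mul, ← Complex.ofReal_sub, Complex.ofReal_re]

/-- A distribution whose largest entry is at most `1 / card J` times its total mass is a mixture
of uniform distributions on sets of size `card J`. -/
theorem exists_mixture_injections {I J : Type} [Fintype I] [DecidableEq I] [Fintype J] [Nonempty J]
    {p : I → ℝ} (hp : ∀ i, 0 ≤ p i) (hpos : 0 < ∑ i, p i)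
    (hmax : ∀ i, Fintype.card J * p i ≤ ∑ i, p i) :
    ∃ (κ : Type) (_ : Fintype κ) (w : κ → ℝ) (e : κ → J → I), (∀ k, 0 ≤ w k) ∧
      (∀ k, Function.Injective (e k)) ∧ ∑ k, w k = ∑ i, p i ∧
      ∀ i, ∑ k, w k * ∑ j, (if e k j = i then (1 / Fintype.card J : ℝ) else 0) = p i := by
  set P := ∑ i, p i with hP
  set M := Fintype.card J with hM
  set N := Fintype.card I with hN
  have hM0 : (0 : ℝ) < M := by exact_mod_cast Fintype.card_pos
  have hMN : M ≤ N := by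
    have h1 : (M : ℝ) * P ≤ N * P := by
      rw [hP, Finset.mul_sum]
      refine (Finset.sum_le_sum fun i _ => hmax i).trans ?_
      rw [Finset.sum_const, nsmul_eq_mul, hN, Finset.card_univ]
    exact_mod_cast le_of_mul_le_mul_right h1 hpos
  obtain ⟨ι⟩ : Nonempty (J ↪ I) := Function.Embedding.nonempty_of_card_le hMN
  classical
  -- Rows in the image of `ι` carry the normalised `p`; the others share equally what the column
  -- sums still need. Nonnegativity is `hmax`. In a Birkhoff decomposition of `D`, each permutation
  -- composed with `ι` is an injection.
  set D : Matrix I I ℝ := Matrix.of fun t i =>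
    if t ∈ Finset.univ.map ι then p i / P else (1 - M * p i / P) / (N - M) with hD
  have hx0 : ∀ i, 0 ≤ 1 - M * p i / P := fun i => by
    rw [sub_nonneg, div_le_one hpos]; exact hmax i
  have hNM : (0 : ℝ) ≤ N - M := sub_nonneg.mpr (by exact_mod_cast hMN)
  have hsumx : ∑ i, (1 - M * p i / P) = N - M := by
    rw [Finset.sum_sub_distrib, ← Finset.sum_div, ← Finset.mul_sum, ← hP,
      mul_div_cancel_right₀ _ hpos.ne']
    simp [hN]
  have hDS : D ∈ doublyStochastic ℝ I := by
    rw [mem_doublyStochastic_iff_sum]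
    refine ⟨fun t i => ?_, fun t => ?_, fun i => ?_⟩
    · simp only [hD, of_apply]
      split_ifs
      · exact div_nonneg (hp i) hpos.le
      · exact div_nonneg (hx0 i) hNM
    · simp only [hD, of_apply]
      split_ifs with ht
      · rw [← Finset.sum_div, ← hP, div_self hpos.ne']
      · rw [← Finset.sum_div, hsumx, div_self]
        have h1 : M < N := by
          have := Finset.card_lt_univ_of_notMem ht
          rwa [Finset.card_map, Finset.card_univ] at this
        have h2 : (M : ℝ) < N := by exact_mod_cast h1
        exact (sub_pos.mpr h2).ne'
    · simp only [hD, of_apply]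
      rw [Finset.sum_ite, Finset.sum_const, Finset.sum_const, Finset.filter_not,
        Finset.filter_mem_eq_inter, Finset.univ_inter, Finset.card_sdiff_of_subset
          (Finset.subset_univ _), Finset.card_map, Finset.card_univ, Finset.card_univ, nsmul_eq_mul,
        nsmul_eq_mul, Nat.cast_sub hMN]
      -- If `N = M` there are no filler rows; the nonnegative defects then sum to zero, so each
      -- vanishes.
      rcases hNM.eq_or_lt with h0 | h0
      · rw [← h0] at hsumx ⊢
        have := (Finset.sum_eq_zero_iff_of_nonneg fun i _ => hx0 i).mp hsumx i (Finset.mem_univ i)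
        rw [zero_mul, add_zero, ← mul_div_assoc]
        linarith
      · rw [mul_div_cancel₀ _ h0.ne']
        ring
  obtain ⟨w, hw0, hw1, hwD⟩ := exists_eq_sum_perm_of_mem_doublyStochastic hDS
  refine ⟨Equiv.Perm I, inferInstance, fun σ => P * w σ, fun σ j => σ (ι j),
    fun σ => mul_nonneg hpos.le (hw0 σ), fun σ => σ.injective.comp ι.injective, ?_, fun i => ?_⟩
  · rw [← Finset.mul_sum, hw1, mul_one]
  · have hDi : ∀ j, ∑ σ, w σ * (if σ (ι j) = i then (1 : ℝ) else 0) = p i / P := by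
      intro j
      have h1 : D (ι j) i = p i / P := by simp [hD]
      rw [← h1, ← hwD, Matrix.sum_apply]
      refine Finset.sum_congr rfl fun σ _ => ?_
      simp [Equiv.toPEquiv_apply, Equiv.Perm.permMatrix, PEquiv.toMatrix_apply, eq_comm]
    calc _ = ∑ j, P / M * ∑ σ, w σ * (if σ (ι j) = i then (1 : ℝ) else 0) := by
          simp_rw [Finset.mul_sum]
          rw [Finset.sum_comm]
          refine Finset.sum_congr rfl fun j _ => Finset.sum_congr rfl fun σ _ => ?_
          split_ifs
          · ring
          · ring
      _ = p i := by
          simp_rw [hDi]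
          rw [Finset.sum_const, Finset.card_univ, nsmul_eq_mul, ← hM]
          field_simp

/-! ### Schmidt data of the states to be compared -/

theorem tensorPower_pureState_sqrt {A B I : Type} [Fintype I] [DecidableEq I] {U : Matrix A I ℂ}
    {V : Matrix B I ℂ} {p : I → ℝ} (hp : ∀ i, 0 < p i) {ψ : EuclideanSpace ℂ (A × B)}
    (hψ : ⇑ψ = schmidtVec U V fun i => √(p i)) (n : ℕ) : tensorPower n (pureState ψ) =
      vecMulVec (schmidtVec (matrixPow n U) (matrixPow n V) fun x => √(∏ i, p (x i)))
        (star (schmidtVec (matrixPow n U) (matrixPow n V) fun x => √(∏ i, p (x i)))) := by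
  rw [tensorPower_pureState hψ]
  have : ∀ x : Fin n → I, ∏ i, √(p (x i)) = √(∏ i, p (x i)) := fun x =>
    (Real.sqrt_prod _ fun i _ => (hp _).le).symm
  simp_rw [this]

/-- The squared Schmidt coefficients of an EPR pair. -/
def eprCoeff : Fin 2 → ℝ := fun _ => 1 / 2

theorem eprCoeff_pos (i : Fin 2) : 0 < eprCoeff i := by simp [eprCoeff]

theorem sum_eprCoeff : ∑ i, eprCoeff i = 1 := by simp [eprCoeff]

theorem prod_eprCoeff {m : ℕ} (x : Fin m → Fin 2) : ∏ i, eprCoeff (x i) = (2 : ℝ) ^ (-(m : ℝ)) := by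
  simp [eprCoeff, Real.rpow_neg]

/-- The operators that carry the Schmidt basis of `|Φ⁺⟩^{⊗ m}`. -/
abbrev eprBasis (m : ℕ) : Matrix (Fin m → Fin 2) (Fin m → Fin 2) ℂ := matrixPow m 1

theorem eprBasis_conjTranspose_mul_self (m : ℕ) : (eprBasis m)ᴴ * eprBasis m = 1 :=
  matrixPow_conjTranspose_mul_self m (by simp)

theorem tensorPower_eprPair (m : ℕ) : tensorPower m (pureState eprPair) =
    vecMulVec (schmidtVec (eprBasis m) (eprBasis m) fun x => √(∏ i, eprCoeff (x i)))
      (star (schmidtVec (eprBasis m) (eprBasis m) fun x => √(∏ i, eprCoeff (x i)))) :=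
  tensorPower_pureState_sqrt eprCoeff_pos eprPair_eq m

/-- The restriction of `√p` to a set. -/
def sqrtOn {I : Type} [DecidableEq I] (p : I → ℝ) (S : Finset I) : I → ℝ :=
  fun i => if i ∈ S then √(p i) else 0

theorem sqrtOn_add_sqrtOn_compl {I : Type} [Fintype I] [DecidableEq I] (p : I → ℝ) (S : Finset I) :
    sqrtOn p S + sqrtOn p Sᶜ = fun i => √(p i) := by
  ext i
  by_cases h : i ∈ S <;> simp [sqrtOn, h]

theorem sum_sqrtOn_sq {I : Type} [Fintype I] [DecidableEq I] {p : I → ℝ} (hp : ∀ i, 0 ≤ p i)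
    (S : Finset I) : ∑ i, sqrtOn p S i ^ 2 = ∑ i ∈ S, p i := by
  have : ∀ i, sqrtOn p S i ^ 2 = if i ∈ S then p i else 0 := by
    intro i
    by_cases h : i ∈ S <;> simp [sqrtOn, h, Real.sq_sqrt (hp i)]
  simp_rw [this]
  simp

theorem sum_compl_eq_one_sub {I : Type} [Fintype I] [DecidableEq I] {p : I → ℝ}
    (hp : ∑ i, p i = 1) (S : Finset I) : ∑ i ∈ Sᶜ, p i = 1 - ∑ i ∈ S, p i := by
  rw [← hp, ← Finset.sum_compl_add_sum S, add_sub_cancel_right]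

/-- The limitation of LOCC transformations in terms of Schmidt coefficients. -/
theorem IsLOCC.one_sub_le_traceNorm_schmidtVec {A B A' B' I J : Type} [Fintype A] [DecidableEq A]
    [Fintype B] [DecidableEq B] [Fintype A'] [DecidableEq A'] [Fintype B'] [DecidableEq B']
    [Fintype I] [DecidableEq I] [Fintype J] [DecidableEq J]
    {Λ : Matrix (A × B) (A × B) ℂ → Matrix (A' × B') (A' × B') ℂ} (h : IsLOCC A B Λ)
    {U : Matrix A I ℂ} {V : Matrix B I ℂ} {U' : Matrix A' J ℂ} {V' : Matrix B' J ℂ}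
    (hU : Uᴴ * U = 1) (hV : Vᴴ * V = 1) (hU' : U'ᴴ * U' = 1) (hV' : V'ᴴ * V' = 1)
    {p : I → ℝ} {q : J → ℝ} (hp : ∀ i, 0 ≤ p i) (hq : ∀ j, 0 ≤ q j) (hp1 : ∑ i, p i = 1)
    (hq1 : ∑ j, q j = 1) (S : Finset I) (S' : Finset J) {c : ℝ} (hc : 0 ≤ c)
    (hS' : ∀ j ∈ S', q j ≤ c) :
    1 - 3 * (c * S.card + (1 - ∑ i ∈ S, p i) + (1 - ∑ j ∈ S', q j)) ≤
      traceNorm (Λ (vecMulVec (schmidtVec U V fun i => √(p i))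
          (star (schmidtVec U V fun i => √(p i)))) -
        vecMulVec (schmidtVec U' V' fun j => √(q j)) (star (schmidtVec U' V' fun j => √(q j)))) := by
  have hnorm : ∀ S : Finset I, sqNorm (schmidtVec U V (sqrtOn p S)) = ∑ i ∈ S, p i := fun S => by
    rw [sqNorm_schmidtVec hU hV, sum_sqrtOn_sq hp]
  have hnorm' : ∀ S : Finset J, sqNorm (schmidtVec U' V' (sqrtOn q S)) = ∑ i ∈ S, q i := fun S => by
    rw [sqNorm_schmidtVec hU' hV', sum_sqrtOn_sq hq]
  have hvs : schmidtVec U V (sqrtOn p S) + schmidtVec U V (sqrtOn p Sᶜ) =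
      schmidtVec U V fun i => √(p i) := by
    rw [← schmidtVec_add, sqrtOn_add_sqrtOn_compl]
  have hts : schmidtVec U' V' (sqrtOn q S') + schmidtVec U' V' (sqrtOn q S'ᶜ) =
      schmidtVec U' V' fun i => √(q i) := by
    rw [← schmidtVec_add, sqrtOn_add_sqrtOn_compl]
  rw [← hvs, ← hts, ← sum_compl_eq_one_sub hp1, ← sum_compl_eq_one_sub hq1, ← hnorm, ← hnorm']
  refine h.one_sub_le_traceNorm _ _ _ _ hc ?_ ?_ ?_ ?_ ?_ ?_
  · rw [hnorm, ← hp1]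
    exact Finset.sum_le_sum_of_subset_of_nonneg (Finset.subset_univ _) fun i _ _ => hp i
  · rw [hvs, sqNorm_schmidtVec hU hV, ← hp1]
    exact Finset.sum_congr rfl fun i _ => Real.sq_sqrt (hp i)
  · rw [hnorm', ← hq1]
    exact Finset.sum_le_sum_of_subset_of_nonneg (Finset.subset_univ _) fun i _ _ => hq i
  · rw [hts, sqNorm_schmidtVec hU' hV', ← hq1]
    exact Finset.sum_congr rfl fun i _ => Real.sq_sqrt (hq i)
  · set D := diagonal (fun j => (sqrtOn q S' j : ℂ)) with hD
    have hDD : Dᴴ = D := by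
      rw [hD, diagonal_conjTranspose]; congr 1; ext i; simp
    have hV'' : V'ᵀ * V'ᵀᴴ = 1 := by
      have : V'ᵀᴴ = V'ᴴᵀ := rfl
      rw [this, ← transpose_mul, hV', transpose_one]
    have h1 : coeffMatrix (schmidtVec U' V' (sqrtOn q S')) *
        (coeffMatrix (schmidtVec U' V' (sqrtOn q S')))ᴴ =
        U' * diagonal (fun j => ((sqrtOn q S' j ^ 2 : ℝ) : ℂ)) * U'ᴴ := by
      rw [coeffMatrix_schmidtVec, ← hD, conjTranspose_mul, conjTranspose_mul, hDD]
      calc _ = U' * (D * (V'ᵀ * V'ᵀᴴ) * D) * U'ᴴ := by simp only [Matrix.mul_assoc]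
        _ = _ := by
          rw [hV'', Matrix.mul_one, hD, diagonal_mul_diagonal]
          simp only [sq, Complex.ofReal_mul]
    rw [h1]
    refine posSemidef_smul_one_sub hU' hc fun j => ?_
    by_cases hj : j ∈ S'
    · simp only [sqrtOn, hj, if_true, Real.sq_sqrt (hq j)]
      exact hS' j hj
    · simpa [sqrtOn, hj] using hc
  · rw [coeffMatrix_schmidtVec]
    refine Nat.cast_le.mpr ((rank_mul_le_left _ _).trans ((rank_mul_le_right _ _).trans ?_))
    rw [rank_diagonal, Fintype.card_subtype]
    refine Finset.card_le_card fun i hi => ?_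
    by_contra hn
    simp [sqrtOn, hn] at hi

/-! ### From rate bounds to extrema and limits -/

/-- The upper bound with `δ = 1` makes the admissible `m` bounded, and the lower one makes them
nonempty, so the supremum in `ℕ` is attained; both bounds then squeeze it. -/
theorem exists_isGreatest_tendsto {Q : ℕ → ℕ → Prop} {E : ℝ}
    (h₁ : ∀ δ > 0, ∀ᶠ n : ℕ in atTop, ∀ m : ℕ, Q n m → (m : ℝ) / n ≤ E + δ)
    (h₂ : ∀ δ > 0, ∀ᶠ n : ℕ in atTop, ∃ m : ℕ, Q n m ∧ E - δ ≤ (m : ℝ) / n) :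
    ∃ R : ℕ → ℝ, (∀ᶠ n : ℕ in atTop, IsGreatest {r | ∃ m : ℕ, r = (m : ℝ) / n ∧ Q n m} (R n)) ∧
      Tendsto R atTop (𝓝 E) := by
  have hR : ∀ᶠ n : ℕ in atTop,
      IsGreatest {r | ∃ m : ℕ, r = (m : ℝ) / n ∧ Q n m} ((sSup {m | Q n m} : ℕ) / n : ℝ) := by
    filter_upwards [h₁ 1 one_pos, h₂ 1 one_pos, eventually_gt_atTop 0] with n h3 h4 hn
    obtain ⟨m₀, hm₀, -⟩ := h4
    have hn' : (0 : ℝ) < n := by exact_mod_cast hn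
    have hb : BddAbove {m | Q n m} := by
      refine ⟨⌈(E + 1) * n⌉₊, fun m hm => ?_⟩
      have := h3 m hm
      rw [div_le_iff₀ hn'] at this
      exact_mod_cast this.trans (Nat.le_ceil _)
    refine ⟨⟨_, rfl, Nat.sSup_mem ⟨m₀, hm₀⟩ hb⟩, ?_⟩
    rintro r ⟨m, rfl, hm⟩
    have : m ≤ sSup {m | Q n m} := le_csSup hb hm
    gcongr
  refine ⟨_, hR, ?_⟩
  rw [Metric.tendsto_nhds]
  intro δ hδ
  filter_upwards [h₁ (δ / 2) (half_pos hδ), h₂ (δ / 2) (half_pos hδ), hR] with n h3 h4 h5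
  obtain ⟨m, hm, hle⟩ := h4
  obtain ⟨m', hm', hQ⟩ := h5.1
  have h6 := h5.2 ⟨m, rfl, hm⟩
  have h7 := h3 m' hQ
  rw [← hm'] at h7
  rw [Real.dist_eq, abs_lt]
  constructor <;> linarith

theorem exists_isLeast_tendsto {Q : ℕ → ℕ → Prop} {E : ℝ}
    (h₁ : ∀ δ > 0, ∀ᶠ n : ℕ in atTop, ∀ m : ℕ, Q n m → E - δ ≤ (m : ℝ) / n)
    (h₂ : ∀ δ > 0, ∀ᶠ n : ℕ in atTop, ∃ m : ℕ, Q n m ∧ (m : ℝ) / n ≤ E + δ) :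
    ∃ R : ℕ → ℝ, (∀ᶠ n : ℕ in atTop, IsLeast {r | ∃ m : ℕ, r = (m : ℝ) / n ∧ Q n m} (R n)) ∧
      Tendsto R atTop (𝓝 E) := by
  have hR : ∀ᶠ n : ℕ in atTop,
      IsLeast {r | ∃ m : ℕ, r = (m : ℝ) / n ∧ Q n m} ((sInf {m | Q n m} : ℕ) / n : ℝ) := by
    filter_upwards [h₂ 1 one_pos] with n h4
    obtain ⟨m₀, hm₀, -⟩ := h4
    refine ⟨⟨_, rfl, Nat.sInf_mem ⟨m₀, hm₀⟩⟩, ?_⟩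
    rintro r ⟨m, rfl, hm⟩
    have : sInf {m | Q n m} ≤ m := Nat.sInf_le hm
    gcongr
  refine ⟨_, hR, ?_⟩
  rw [Metric.tendsto_nhds]
  intro δ hδ
  filter_upwards [h₁ (δ / 2) (half_pos hδ), h₂ (δ / 2) (half_pos hδ), hR] with n h3 h4 h5
  obtain ⟨m, hm, hle⟩ := h4
  obtain ⟨m', hm', hQ⟩ := h5.1
  have h6 := h5.2 ⟨m, rfl, hm⟩
  have h7 := h3 m' hQ
  rw [← hm'] at h7
  rw [Real.dist_eq, abs_lt]
  constructor <;> linarith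

theorem eventually_two_rpow_neg_le {δ η : ℝ} (hδ : 0 < δ) (hη : 0 < η) :
    ∀ᶠ n : ℕ in atTop, (2 : ℝ) ^ (-(n * δ)) ≤ η := by
  filter_upwards [eventually_ge_atTop ⌈-Real.logb 2 η / δ⌉₊] with n hn
  have h1 : -Real.logb 2 η / δ ≤ n := (Nat.le_ceil _).trans (by exact_mod_cast hn)
  rw [div_le_iff₀ hδ] at h1
  rw [← Real.le_logb_iff_rpow_le one_lt_two hη]
  linarith

/-! ### The four rate bounds -/

section Rates

variable {A B I : Type} [Fintype A] [DecidableEq A] [Fintype B] [DecidableEq B] [Fintype I]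
  [DecidableEq I] {U : Matrix A I ℂ} {V : Matrix B I ℂ} {p : I → ℝ} {ψ : EuclideanSpace ℂ (A × B)}
  {H ε δ : ℝ}

/-- The source has effective Schmidt rank at most `2 ^ (n (H + δ / 2))`, while the target
coefficients are all `2 ^ (-m)`. If `m > n (H + δ)`, their product is at most `2 ^ (-n δ / 2)`. -/
theorem distillation_converse (hU : Uᴴ * U = 1) (hV : Vᴴ * V = 1) (hp0 : ∀ i, 0 < p i)
    (hp1 : ∑ i, p i = 1) (hψ : ⇑ψ = schmidtVec U V fun i => √(p i))
    (hH : H = -∑ i, p i * Real.logb 2 (p i)) (hε : ε < 1) (hδ : 0 < δ) :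
    ∀ᶠ n : ℕ in atTop, ∀ m : ℕ,
      (∃ Λ, IsLOCC (A' := Fin m → Fin 2) (B' := Fin m → Fin 2) (Fin n → A) (Fin n → B) Λ ∧
        traceNorm (Λ (tensorPower n (pureState ψ)) - tensorPower m (pureState eprPair)) ≤ ε) →
      (m : ℝ) / n ≤ H + δ := by
  -- Only two error terms survive, since the EPR pairs have no tail; three times their sum is at
  -- most `(1 - ε) / 2`.
  have hη : 0 < (1 - ε) / 12 := by linarith
  filter_upwards [eventually_one_sub_sum_typicalSet_le hp0 hp1 hH (half_pos hδ) hη,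
    eventually_two_rpow_neg_le (half_pos hδ) hη, eventually_gt_atTop 0] with n h1 h2 hn m hm
  obtain ⟨Λ, hΛ, hle⟩ := hm
  have hn' : (0 : ℝ) < n := by exact_mod_cast hn
  by_contra hcon
  rw [not_le, lt_div_iff₀ hn'] at hcon
  rw [tensorPower_pureState_sqrt hp0 hψ, tensorPower_eprPair] at hle
  have key := hΛ.one_sub_le_traceNorm_schmidtVec (matrixPow_conjTranspose_mul_self n hU)
    (matrixPow_conjTranspose_mul_self n hV) (eprBasis_conjTranspose_mul_self m)
    (eprBasis_conjTranspose_mul_self m) (fun x => Finset.prod_nonneg fun i _ => (hp0 (x i)).le)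
    (fun x => Finset.prod_nonneg fun i _ => (eprCoeff_pos (x i)).le) (sum_prod_eq_one hp1 n)
    (sum_prod_eq_one sum_eprCoeff m) (typicalSet p H (δ / 2) n) Finset.univ
    (c := (2 : ℝ) ^ (-(m : ℝ))) (by positivity) (fun x _ => (prod_eprCoeff x).le)
  rw [sum_prod_eq_one sum_eprCoeff m] at key
  have h3 : (2 : ℝ) ^ (-(m : ℝ)) * (typicalSet p H (δ / 2) n).card ≤ (1 - ε) / 12 := by
    refine le_trans ?_ h2
    refine (mul_le_mul_of_nonneg_left (card_typicalSet_le hp0 hp1 H (δ / 2) n)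
      (by positivity)).trans ?_
    rw [← Real.rpow_add two_pos]
    exact Real.rpow_le_rpow_of_exponent_le one_le_two (by linarith)
  linarith

/-- The roles are exchanged: the source rank is `2 ^ m`, and the typical target coefficients are at
most `2 ^ (-n (H - δ / 2))`. -/
theorem dilution_converse (hU : Uᴴ * U = 1) (hV : Vᴴ * V = 1) (hp0 : ∀ i, 0 < p i)
    (hp1 : ∑ i, p i = 1) (hψ : ⇑ψ = schmidtVec U V fun i => √(p i))
    (hH : H = -∑ i, p i * Real.logb 2 (p i)) (hε : ε < 1) (hδ : 0 < δ) :
    ∀ᶠ n : ℕ in atTop, ∀ m : ℕ,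
      (∃ Λ, IsLOCC (A' := Fin n → A) (B' := Fin n → B) (Fin m → Fin 2) (Fin m → Fin 2) Λ ∧
        traceNorm (Λ (tensorPower m (pureState eprPair)) - tensorPower n (pureState ψ)) ≤ ε) →
      H - δ ≤ (m : ℝ) / n := by
  have hη : 0 < (1 - ε) / 12 := by linarith
  filter_upwards [eventually_one_sub_sum_typicalSet_le hp0 hp1 hH (half_pos hδ) hη,
    eventually_two_rpow_neg_le (half_pos hδ) hη, eventually_gt_atTop 0] with n h1 h2 hn m hm
  obtain ⟨Λ, hΛ, hle⟩ := hm
  have hn' : (0 : ℝ) < n := by exact_mod_cast hn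
  by_contra hcon
  rw [not_le, div_lt_iff₀ hn'] at hcon
  rw [tensorPower_pureState_sqrt hp0 hψ, tensorPower_eprPair] at hle
  have key := hΛ.one_sub_le_traceNorm_schmidtVec (eprBasis_conjTranspose_mul_self m)
    (eprBasis_conjTranspose_mul_self m) (matrixPow_conjTranspose_mul_self n hU)
    (matrixPow_conjTranspose_mul_self n hV)
    (fun x => Finset.prod_nonneg fun i _ => (eprCoeff_pos (x i)).le)
    (fun x => Finset.prod_nonneg fun i _ => (hp0 (x i)).le)
    (sum_prod_eq_one sum_eprCoeff m) (sum_prod_eq_one hp1 n) Finset.univ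
    (typicalSet p H (δ / 2) n) (c := (2 : ℝ) ^ (-(n * (H - δ / 2)))) (by positivity)
    (fun x hx => (mem_typicalSet.mp hx).2)
  rw [sum_prod_eq_one sum_eprCoeff m] at key
  have h3 : (2 : ℝ) ^ (-(n * (H - δ / 2))) * (Finset.univ : Finset (Fin m → Fin 2)).card ≤
      (1 - ε) / 12 := by
    refine le_trans ?_ h2
    have : (((Finset.univ : Finset (Fin m → Fin 2)).card : ℕ) : ℝ) = (2 : ℝ) ^ (m : ℝ) := by
      simp
    rw [this, ← Real.rpow_add two_pos]
    exact Real.rpow_le_rpow_of_exponent_le one_le_two (by linarith)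
  linarith

theorem distillation_achievability (hU : Uᴴ * U = 1) (hV : Vᴴ * V = 1) (hp0 : ∀ i, 0 < p i)
    (hp1 : ∑ i, p i = 1) (hψ : ⇑ψ = schmidtVec U V fun i => √(p i))
    (hH : H = -∑ i, p i * Real.logb 2 (p i)) (hε : 0 < ε) (hδ : 0 < δ) :
    ∀ᶠ n : ℕ in atTop, ∃ m : ℕ,
      (∃ Λ, IsLOCC (A' := Fin m → Fin 2) (B' := Fin m → Fin 2) (Fin n → A) (Fin n → B) Λ ∧
        traceNorm (Λ (tensorPower n (pureState ψ)) - tensorPower m (pureState eprPair)) ≤ ε) ∧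
      H - δ ≤ (m : ℝ) / n := by
  -- The final error is `2 * (1 - P)`, whence `ε / 2`; the bound `1 / 2` keeps the typical mass
  -- large enough for `hmax`.
  have hη : 0 < min (ε / 2) (1 / 2) := by positivity
  have hδ4 : 0 < δ / 4 := by positivity
  filter_upwards [eventually_one_sub_sum_typicalSet_le hp0 hp1 hH hδ4 hη,
    eventually_two_rpow_neg_le hδ4 one_half_pos, eventually_ge_atTop ⌈2 / δ⌉₊,
    eventually_gt_atTop 0] with n h1 h2 h3 hn
  have hn' : (0 : ℝ) < n := by exact_mod_cast hn
  have h3' : 1 ≤ n * (δ / 2) := by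
    have : 2 / δ ≤ n := (Nat.le_ceil _).trans (by exact_mod_cast h3)
    rw [div_le_iff₀ hδ] at this
    linarith
  set T := typicalSet p H (δ / 4) n with hT
  set P := ∑ x ∈ T, ∏ i, p (x i) with hP
  have hPε : 1 - P ≤ ε / 2 := h1.trans (min_le_left _ _)
  have hP2 : 1 / 2 ≤ P := by linarith [h1.trans (min_le_right _ _)]
  have hpn : ∀ x : Fin n → I, 0 < ∏ i, p (x i) := fun x => Finset.prod_pos fun i _ => hp0 _
  have hP1 : P ≤ 1 := by
    rw [← sum_prod_eq_one hp1 n]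
    exact Finset.sum_le_sum_of_subset_of_nonneg (Finset.subset_univ _) fun x _ _ => (hpn x).le
  have hPT : ∑ x : T, ∏ i, p (x.1 i) = P := Finset.sum_coe_sort T fun x => ∏ i, p (x i)
  -- With typicality width `δ / 4`, the product of `2 ^ m` and a typical probability is at most `2 ^
  -- (-n δ / 4)` when the floored number is positive. Otherwise `m = 0` and the bound is trivial.
  -- The other `δ / 2` absorbs the rounding.
  set m := ⌊n * (H - δ / 2)⌋₊ with hm
  have hmax : ∀ x : T, (Fintype.card (Fin m → Fin 2) : ℝ) * ∏ i, p (x.1 i) ≤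
      ∑ x : T, ∏ i, p (x.1 i) := by
    intro x
    rw [hPT]
    rcases le_or_gt (n * (H - δ / 2)) 0 with h0 | h0
    · have hm0 : m = 0 := Nat.floor_of_nonpos h0
      have : Fintype.card (Fin m → Fin 2) = 1 := by simp [hm0]
      rw [this, Nat.cast_one, one_mul]
      exact Finset.single_le_sum (f := fun x : Fin n → I => ∏ i, p (x i))
        (fun x _ => (hpn x).le) x.2
    · refine le_trans ?_ hP2
      refine le_trans ?_ h2
      have h4 : (Fintype.card (Fin m → Fin 2) : ℝ) ≤ (2 : ℝ) ^ (n * (H - δ / 2)) := by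
        have : (Fintype.card (Fin m → Fin 2) : ℝ) = (2 : ℝ) ^ (m : ℝ) := by simp
        rw [this]
        exact Real.rpow_le_rpow_of_exponent_le one_le_two (Nat.floor_le h0.le)
      refine (mul_le_mul h4 (mem_typicalSet.mp x.2).2 (hpn _).le (by positivity)).trans ?_
      rw [← Real.rpow_add two_pos]
      exact Real.rpow_le_rpow_of_exponent_le one_le_two (by linarith)
  refine ⟨m, ?_, ?_⟩
  · obtain ⟨κ, _, w, e, hw0, he, hw, hwe⟩ := exists_mixture_injections (J := Fin m → Fin 2)
      (fun x : T => (hpn x.1).le) (by rw [hPT]; linarith) hmax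
    have hunif : ∀ j : Fin m → Fin 2, ∏ i, eprCoeff (j i) =
        1 / (Fintype.card (Fin m → Fin 2) : ℝ) := by
      intro j
      simp [eprCoeff]
    obtain ⟨Λ, hΛ, hle⟩ := exists_isLOCC_traceNorm_le (e := fun k j => (e k j).1)
      (matrixPow_conjTranspose_mul_self n hU) (matrixPow_conjTranspose_mul_self n hV)
      (eprBasis_conjTranspose_mul_self m) (eprBasis_conjTranspose_mul_self m) hpn
      (fun x => Finset.prod_nonneg fun i _ => (eprCoeff_pos (x i)).le) hw0
      (fun k => Subtype.val_injective.comp (he k)) (fun x => by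
        by_cases hx : x ∈ T
        · refine le_of_eq ?_
          rw [← hwe ⟨x, hx⟩]
          refine Finset.sum_congr rfl fun k _ => ?_
          congr 1
          refine Finset.sum_congr rfl fun j _ => ?_
          rw [hunif]
          simp only [Subtype.ext_iff]
        · refine le_of_eq_of_le (Finset.sum_eq_zero fun k _ => ?_) (hpn x).le
          rw [Finset.sum_eq_zero fun j _ => if_neg fun h : (e k j).1 = x =>
            hx (h ▸ (e k j).2), mul_zero]) 0
    refine ⟨Λ, hΛ, ?_⟩
    rw [tensorPower_pureState_sqrt hp0 hψ, tensorPower_eprPair]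
    rw [add_zero] at hle
    refine hle.trans ?_
    rw [sum_prod_eq_one hp1, sum_prod_eq_one sum_eprCoeff, hw, hPT, abs_of_nonpos (by linarith)]
    simp only [sqNorm, Pi.zero_apply, norm_zero]
    simp
    linarith
  · rw [le_div_iff₀ hn']
    have := Nat.lt_floor_add_one (n * (H - δ / 2))
    rw [← hm] at this
    linarith

theorem dilution_achievability [Nonempty A] [Nonempty B] (hU : Uᴴ * U = 1) (hV : Vᴴ * V = 1)
    (hp0 : ∀ i, 0 < p i) (hp1 : ∑ i, p i = 1) (hψ : ⇑ψ = schmidtVec U V fun i => √(p i))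
    (hH : H = -∑ i, p i * Real.logb 2 (p i)) (hε : 0 < ε) (hε1 : ε < 1) (hδ : 0 < δ) :
    ∀ᶠ n : ℕ in atTop, ∃ m : ℕ,
      (∃ Λ, IsLOCC (A' := Fin n → A) (B' := Fin n → B) (Fin m → Fin 2) (Fin m → Fin 2) Λ ∧
        traceNorm (Λ (tensorPower m (pureState eprPair)) - tensorPower n (pureState ψ)) ≤ ε) ∧
      (m : ℝ) / n ≤ H + δ := by
  -- The final error is `2 (1 - P) + 2 √P √(1 - P)`, at most `ε² / 8 + ε / 2`.
  have hη : 0 < ε ^ 2 / 16 := by positivity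
  -- The ceiling in `ℕ` exceeds its argument by less than one only if the argument is not too
  -- negative.
  have hH0 : 0 ≤ H := by
    rw [hH, neg_nonneg]
    refine Finset.sum_nonpos fun i _ => mul_nonpos_of_nonneg_of_nonpos (hp0 i).le ?_
    refine Real.logb_nonpos one_lt_two (hp0 i).le ?_
    rw [← hp1]
    exact Finset.single_le_sum (fun i _ => (hp0 i).le) (Finset.mem_univ i)
  filter_upwards [eventually_one_sub_sum_typicalSet_le hp0 hp1 hH (half_pos hδ) hη,
    eventually_ge_atTop ⌈2 / δ⌉₊, eventually_gt_atTop 0] with n h1 h3 hn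
  have hn' : (0 : ℝ) < n := by exact_mod_cast hn
  have h3' : 1 ≤ n * (δ / 2) := by
    have : 2 / δ ≤ n := (Nat.le_ceil _).trans (by exact_mod_cast h3)
    rw [div_le_iff₀ hδ] at this
    linarith
  set T := typicalSet p H (δ / 2) n with hT
  set P := ∑ x ∈ T, ∏ i, p (x i) with hP
  have hpn : ∀ x : Fin n → I, 0 < ∏ i, p (x i) := fun x => Finset.prod_pos fun i _ => hp0 _
  have hP1 : P ≤ 1 := by
    rw [← sum_prod_eq_one hp1 n]
    exact Finset.sum_le_sum_of_subset_of_nonneg (Finset.subset_univ _) fun x _ _ => (hpn x).le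
  have hPT : ∑ x : T, ∏ i, p (x.1 i) = P := Finset.sum_coe_sort T fun x => ∏ i, p (x i)
  set m := ⌈n * (H + δ / 2)⌉₊ with hm
  have hcard : Fintype.card T ≤ Fintype.card (Fin m → Fin 2) := by
    have h4 : ((T.card : ℕ) : ℝ) ≤ (Fintype.card (Fin m → Fin 2) : ℝ) := by
      have : (Fintype.card (Fin m → Fin 2) : ℝ) = (2 : ℝ) ^ (m : ℝ) := by simp
      rw [this]
      exact (card_typicalSet_le hp0 hp1 H (δ / 2) n).trans
        (Real.rpow_le_rpow_of_exponent_le one_le_two (Nat.le_ceil _))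
    rw [Fintype.card_coe]
    exact_mod_cast h4
  obtain ⟨ι⟩ := Function.Embedding.nonempty_of_card_le hcard
  refine ⟨m, ?_, ?_⟩
  · set Un := matrixPow n U with hUn
    set Vn := matrixPow n V with hVn
    have hUn' := matrixPow_conjTranspose_mul_self n hU
    have hVn' := matrixPow_conjTranspose_mul_self n hV
    have hsub : ∀ {C : Type} [Fintype C] {W : Matrix C (Fin n → I) ℂ}, Wᴴ * W = 1 →
        (W.submatrix id (Subtype.val : T → _))ᴴ * W.submatrix id (Subtype.val : T → _) = 1 := by
      intro C _ W hW
      ext x y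
      have := congrFun (congrFun hW x.1) y.1
      simp only [mul_apply, conjTranspose_apply, submatrix_apply, id] at this ⊢
      rw [this, one_apply, one_apply]
      simp only [Subtype.ext_iff]
    have hsplit : schmidtVec (Un.submatrix id (Subtype.val : T → _))
        (Vn.submatrix id (Subtype.val : T → _)) (fun x => √(∏ i, p (x.1 i))) +
        schmidtVec Un Vn (sqrtOn (fun x => ∏ i, p (x i)) Tᶜ) =
        schmidtVec Un Vn fun x => √(∏ i, p (x i)) := by
      rw [← sqrtOn_add_sqrtOn_compl (fun x : Fin n → I => ∏ i, p (x i)) T, schmidtVec_add]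
      congr 1
      ext y
      simp only [schmidtVec_apply, submatrix_apply, id, sqrtOn]
      rw [Finset.sum_coe_sort T fun x =>
        ((√(∏ i, p (x i)) : ℝ) : ℂ) * (Un y.1 x * Vn y.2 x)]
      rw [← Finset.sum_subset (Finset.subset_univ T)]
      · exact Finset.sum_congr rfl fun x hx => by rw [if_pos hx]
      · intro x _ hx
        rw [if_neg hx]; simp
    have hb : sqNorm (schmidtVec Un Vn (sqrtOn (fun x => ∏ i, p (x i)) Tᶜ)) = 1 - P := by
      rw [sqNorm_schmidtVec hUn' hVn', sum_sqrtOn_sq fun x => (hpn x).le,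
        sum_compl_eq_one_sub (sum_prod_eq_one hp1 n)]
    have hw1 : ∑ _k : Fin m → Fin 2, (2 : ℝ) ^ (-(m : ℝ)) = 1 := by
      rw [← sum_prod_eq_one sum_eprCoeff m]
      exact Finset.sum_congr rfl fun x _ => (prod_eprCoeff x).symm
    -- For each `x` and `j` exactly one translation `k` sends `ι j` to `x`, so the uniform mixture
    -- of translates has mass `P * 2 ^ (-m)` at every point. The atypical part of the target enters
    -- as the perturbation `b`.
    obtain ⟨Λ, hΛ, hle⟩ := exists_isLOCC_traceNorm_le (J := T)
      (w := fun _ : Fin m → Fin 2 => (2 : ℝ) ^ (-(m : ℝ)))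
      (e := fun k j => ι j + k) (eprBasis_conjTranspose_mul_self m)
      (eprBasis_conjTranspose_mul_self m) (hsub hUn') (hsub hVn')
      (fun x => Finset.prod_pos fun i _ => eprCoeff_pos (x i)) (fun x : T => (hpn x.1).le)
      (fun _ => by positivity) (fun k => (add_left_injective k).comp ι.injective) (fun x => by
        rw [← Finset.mul_sum, Finset.sum_comm, prod_eprCoeff]
        refine mul_le_of_le_one_right (by positivity) ?_
        rw [← hPT] at hP1
        refine le_trans (le_of_eq (Finset.sum_congr rfl fun j _ => ?_)) hP1
        rw [Finset.sum_eq_single (x - ι j)]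
        · simp
        · intro k _ hk
          refine if_neg fun h => hk ?_
          rw [← h]; simp
        · simp)
      (schmidtVec Un Vn (sqrtOn (fun x => ∏ i, p (x i)) Tᶜ))
    refine ⟨Λ, hΛ, ?_⟩
    rw [tensorPower_pureState_sqrt hp0 hψ, tensorPower_eprPair]
    rw [hsplit, sum_prod_eq_one sum_eprCoeff, hw1, hPT, hb] at hle
    refine hle.trans ?_
    have h5 : √P ≤ 1 := Real.sqrt_le_one.mpr hP1
    have h6 : √(1 - P) ≤ ε / 4 := by
      refine (Real.sqrt_le_sqrt h1).trans (le_of_eq ?_)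
      rw [Real.sqrt_eq_iff_mul_self_eq (by positivity) (by positivity)]
      ring
    have h7 : √P * √(1 - P) ≤ 1 * (ε / 4) :=
      mul_le_mul h5 h6 (Real.sqrt_nonneg _) zero_le_one
    simp only [sub_self, abs_zero, zero_mul, add_zero, one_mul] at h7 ⊢
    nlinarith
  · rw [div_le_iff₀ hn']
    have := Nat.ceil_lt_add_one (a := n * (H + δ / 2)) (by positivity)
    rw [← hm] at this
    linarith

end Rates

end

theorem mainTheorem3 {A B : Type} [Fintype A] [DecidableEq A] [Fintype B] [DecidableEq B]
    (ψ : EuclideanSpace ℂ (A × B)) (hψ : ‖ψ‖ = 1) :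
    HasEntanglementCost (pureState ψ) (vonNeumannEntropy (reducedA (pureState ψ))) ∧
    HasDistillableEntanglement (pureState ψ) (vonNeumannEntropy (reducedA (pureState ψ))) ∧
    vonNeumannEntropy (reducedA (pureState ψ)) = vonNeumannEntropy (reducedB (pureState ψ)) := by
  obtain ⟨I, _, _, U, V, p, hp0, hU, hV, hs⟩ := exists_schmidtVec_eq ⇑ψ
  have hA := vonNeumannEntropy_reducedA hU hV (fun i => (hp0 i).le) hs
  have hB := vonNeumannEntropy_reducedB hU hV (fun i => (hp0 i).le) hs
  have hnorm : sqNorm ⇑ψ = 1 := by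
    have := EuclideanSpace.norm_sq_eq ψ
    rw [hψ] at this
    rw [sqNorm, ← this, one_pow]
  have hp1 : ∑ i, p i = 1 := by
    rw [← hnorm, hs, sqNorm_schmidtVec hU hV]
    exact Finset.sum_congr rfl fun i _ => (Real.sq_sqrt (hp0 i).le).symm
  -- The protocol for dilution needs a basis state to output on unsuccessful outcomes.
  have hne : Nonempty (A × B) := by
    by_contra h
    rw [not_nonempty_iff] at h
    simp [sqNorm] at hnorm
  obtain ⟨a, b⟩ := hne
  have : Nonempty A := ⟨a⟩
  have : Nonempty B := ⟨b⟩
  have hsmall : ∀ᶠ ε in 𝓝[>] (0 : ℝ), ε ∈ Set.Ioo (0 : ℝ) 1 := Ioo_mem_nhdsGT one_pos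
  refine ⟨?_, ?_, hA.trans hB.symm⟩
  · have key : ∀ ε ∈ Set.Ioo (0 : ℝ) 1, _ := fun ε hε => exists_isLeast_tendsto
      (fun δ hδ => dilution_converse hU hV hp0 hp1 hs hA hε.2 hδ)
      (fun δ hδ => dilution_achievability hU hV hp0 hp1 hs hA hε.1 hε.2 hδ)
    choose! R hR using key
    -- The inner limit is the entropy for every `ε` in `(0, 1)`, so the function `L` is constant.
    exact ⟨R, fun _ => _, hsmall.mono hR, tendsto_const_nhds⟩
  · have key : ∀ ε ∈ Set.Ioo (0 : ℝ) 1, _ := fun ε hε => exists_isGreatest_tendsto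
      (fun δ hδ => distillation_converse hU hV hp0 hp1 hs hA hε.2 hδ)
      (fun δ hδ => distillation_achievability hU hV hp0 hp1 hs hA hε.1 hδ)
    choose! R hR using key
    exact ⟨R, fun _ => _, hsmall.mono hR, tendsto_const_nhds⟩
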